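/- **Theorem.** Let $G$ be a finite group generated by a set $S$. (a) There is a closed simplicial surface $X$ with $\mathrm{Aut}(X)\cong G$. (b) Suppose that $S=\{g_1,\dots,g_n\}$ has $n\ge 2$ elements (listed in some order, without repetition) and $1\notin S$. Let $N=6$ if $n=2$ and $N=2n+6$ if $n>2$, and let $\Gamma_{G,S}$ be the graph with nodes $x_{i,h}$ $(1\le i\le N,\ h\in G)$ whose edges, for all $h\in G$, are as follows, with the indicated colours. * If $n=2$: red: $x_{1,h}x_{2,h}$, $x_{3,h}x_{4,hg_1}$, $x_{5,h}x_{6,hg_2}$; green: $x_{2,h}x_{3,h}$, $x_{1,h}x_{4,h}$, $x_{5,h}x_{6,h}$; blue: $x_{1,h}x_{3,h}$, $x_{2,h}x_{6,h}$, $x_{4,h}x_{5,h}$. * If $n>2$: red: $x_{1,h}x_{6,h}$, $x_{2,h}x_{3,h}$, $x_{4,h}x_{5,h}$, and $x_{2j+5,h}x_{2j+6,hg_j}$ for $1\le j\le n$; green: $x_{1,h}x_{2,h}$, $x_{3,h}x_{7,h}$, $x_{4,h}x_{6,h}$, $x_{5,h}x_{8,h}$, and $x_{2i+5,h}x_{2i+6,h}$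 for $2\le i\le n$; blue: $x_{1,h}x_{3,h}$, $x_{2,h}x_{4,h}$, $x_{5,h}x_{7,h}$, $x_{6,h}x_{2n+6,h}$, and $x_{2i+4,h}x_{2i+5,h}$ for $2\le i\le n$. Then $\Gamma_{G,S}$ is a cubic graph, and the colours are well defined on its edges and form a proper 3-edge-colouring, which is invariant under the maps $\sigma_m:x_{i,h}\mapsto x_{i,mh}$ $(m\in G)$. The cycles of $\Gamma_{G,S}$ whose edges alternate between two colours form a cycle double cover (every edge lies on exactly two of them), which is also invariant under all $\sigma_m$. There is a closed simplicial surface $X_{G,S}$ whose face graph is $\Gamma_{G,S}$ and whose vertices are the cycles of this cover, a vertex being incident to the edges and faces on its cycle. If moreover $g_1g_2\ne 1$ in the case $n=2$, then $\mathrm{Aut}(X_{G,S})\cong G$, through an isomorphism under which $m\in G$ acts on the faces of $X_{G,S}$ as $\sigma_m$. Here a *closed simplicial surface* is a countable set partitioned into non-empty sets of vertices, edges and faces with an incidence relation (of vertices with edges, edges with faces, and vertices with faces) such that: each edge has exactly two vertices and lies on exactly two faces; each face has exactly three vertices and exactly three edges, and each of its vertices lies on exactly two of its edges; and the faces at each vertex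 are finite in number, at least three, and can be arranged in a cyclic sequence in which consecutive faces share an edge at that vertex. Its *face graph* has the faces as nodes and the edges as edges, an edge joining the two faces it is incident to. An *automorphism* is an incidence-preserving permutation of the surface which, together with its inverse, restricts for every face to an isomorphism from the vertices and edges of that face onto those of the image face. -/

import Mathlib

universe u v

/-- A closed simplicial surface on the set `α` of all its vertices, edges and faces.
`lt A B` is the incidence `A < B`. -/
structure SimplicialSurface (α : Type u) where
  X0 : Set α
  X1 : Set α
  X2 : Set α
  lt : α → α → Prop
  countable : Countable α
  X0_nonempty : X0.Nonempty
  X1_nonempty : X1.Nonempty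
  X2_nonempty : X2.Nonempty
  union_eq : X0 ∪ X1 ∪ X2 = Set.univ
  disjoint01 : Disjoint X0 X1
  disjoint02 : Disjoint X0 X2
  disjoint12 : Disjoint X1 X2
  lt_type : ∀ A B, lt A B →
    (A ∈ X0 ∧ B ∈ X1) ∨ (A ∈ X1 ∧ B ∈ X2) ∨ (A ∈ X0 ∧ B ∈ X2)
  edge_vertices : ∀ e ∈ X1, {V | V ∈ X0 ∧ lt V e}.ncard = 2
  face_edges : ∀ F ∈ X2, {e | e ∈ X1 ∧ lt e F}.ncard = 3
  face_vertices : ∀ F ∈ X2, {V | V ∈ X0 ∧ lt V F}.ncard = 3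
  face_corner : ∀ F ∈ X2, ∀ V ∈ X0, lt V F → {e | e ∈ X1 ∧ lt V e ∧ lt e F}.ncard = 2
  edge_faces : ∀ e ∈ X1, {F | F ∈ X2 ∧ lt e F}.ncard = 2
  /-- Umbrella condition: the faces at `V` are arranged, without repetition, in a finite cyclic
  sequence of length at least three, consecutive faces sharing an edge at `V`. -/
  umbrella : ∀ V ∈ X0, ∃ (n : ℕ) (U : ZMod n → α), 3 ≤ n ∧ Function.Injective U ∧
    Set.range U = {F | F ∈ X2 ∧ lt V F} ∧
    ∀ i : ZMod n, ∃ e ∈ X1, lt V e ∧ lt e (U i) ∧ lt e (U (i + 1))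

namespace SimplicialSurface

/-- Homomorphisms of simplicial surfaces: incidence is preserved, and for every face the
restriction to the vertices and edges incident to it is an isomorphism onto the vertices and edges
incident to its image. -/
structure IsHom {α : Type u} {β : Type v} (X : SimplicialSurface α) (Y : SimplicialSurface β)
    (π : α → β) : Prop where
  map_lt : ∀ A B, X.lt A B → Y.lt (π A) (π B)
  face_bijOn : ∀ F ∈ X.X2, Set.BijOn π {A | X.lt A F} {B | Y.lt B (π F)}
  face_lt_iff : ∀ F ∈ X.X2, ∀ A B, X.lt A F → X.lt B F → (X.lt A B ↔ Y.lt (π A) (π B))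

/-- A homomorphism maps faces to faces. -/
theorem IsHom.map_face {α : Type u} {β : Type v} {X : SimplicialSurface α}
    {Y : SimplicialSurface β} {π : α → β} (h : IsHom X Y π) {F : α} (hF : F ∈ X.X2) :
    π F ∈ Y.X2 := by
  obtain ⟨e, he1, he⟩ : ({e | e ∈ X.X1 ∧ X.lt e F}).Nonempty := by
    apply Set.nonempty_of_ncard_ne_zero
    rw [X.face_edges F hF]; norm_num
  obtain ⟨V, -, hV⟩ : ({V | V ∈ X.X0 ∧ X.lt V e}).Nonempty := by
    apply Set.nonempty_of_ncard_ne_zero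
    rw [X.edge_vertices e he1]; norm_num
  have h1 := Y.lt_type _ _ (h.map_lt _ _ hV)
  have h2 := Y.lt_type _ _ (h.map_lt _ _ he)
  have d01 : π e ∈ Y.X0 → π e ∉ Y.X1 := fun h => Set.disjoint_left.1 Y.disjoint01 h
  have d02 : π e ∈ Y.X0 → π e ∉ Y.X2 := fun h => Set.disjoint_left.1 Y.disjoint02 h
  tauto

theorem IsHom.id {α : Type u} (X : SimplicialSurface α) : IsHom X X (fun a => a) where
  map_lt _ _ h := h
  face_bijOn _ _ := Set.bijOn_id _
  face_lt_iff _ _ _ _ _ _ := Iff.rfl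

theorem IsHom.comp {α β γ : Type*} {X : SimplicialSurface α} {Y : SimplicialSurface β}
    {Z : SimplicialSurface γ} {ρ : β → γ} {π : α → β} (hρ : IsHom Y Z ρ) (hπ : IsHom X Y π) :
    IsHom X Z (fun a => ρ (π a)) where
  map_lt _ _ h := hρ.map_lt _ _ (hπ.map_lt _ _ h)
  face_bijOn F hF := (hρ.face_bijOn _ (hπ.map_face hF)).comp (hπ.face_bijOn F hF)
  face_lt_iff F hF A B hA hB := (hπ.face_lt_iff F hF A B hA hB).trans
    (hρ.face_lt_iff _ (hπ.map_face hF) _ _ (hπ.map_lt _ _ hA) (hπ.map_lt _ _ hB))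

/-- The automorphism group: bijective homomorphisms `X → X` whose inverse is a homomorphism, under
composition. -/
def Aut {α : Type u} (X : SimplicialSurface α) : Subgroup (Equiv.Perm α) where
  carrier := {π | IsHom X X π ∧ IsHom X X π.symm}
  mul_mem' := fun ha hb => ⟨ha.1.comp hb.1, hb.2.comp ha.2⟩
  one_mem' := ⟨IsHom.id X, IsHom.id X⟩
  inv_mem' := fun ha => ⟨ha.2, ha.1⟩

/-- An identification of the face graph of `X` (nodes are the faces, edges are the edges of `X`,
and an edge joins the two faces it is incident to) with the simple graph `Γ`. -/
structure FaceGraphIso {α : Type u} (X : SimplicialSurface α) {N : Type v} (Γ : SimpleGraph N) where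
  faceEquiv : X.X2 ≃ N
  edgeEquiv : X.X1 ≃ Γ.edgeSet
  edge_lt_face_iff : ∀ (e : X.X1) (F : X.X2),
    X.lt e F ↔ faceEquiv F ∈ (edgeEquiv e : Sym2 N)

/-- An identification of `X` with the surface given by the graph `Γ` and a collection `𝒞` of cycles
(edge sets) of `Γ`: the face graph is `Γ`, the vertices are the cycles in `𝒞`, and a vertex is
incident to the edges and nodes (faces) on its cycle. -/
structure CoverIso {α : Type u} (X : SimplicialSurface α) {N : Type v} (Γ : SimpleGraph N)
    (𝒞 : Set (Set (Sym2 N))) extends FaceGraphIso X Γ where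
  vertexEquiv : X.X0 ≃ 𝒞
  vertex_lt_edge_iff : ∀ (V : X.X0) (e : X.X1),
    X.lt V e ↔ (edgeEquiv e : Sym2 N) ∈ (vertexEquiv V : Set (Sym2 N))
  vertex_lt_face_iff : ∀ (V : X.X0) (F : X.X2),
    X.lt V F ↔ ∃ d ∈ (vertexEquiv V : Set (Sym2 N)), faceEquiv F ∈ d

end SimplicialSurface

/-- `C` is the edge set of a cycle of `Γ`. -/
def IsCycleEdgeSet {N : Type u} (Γ : SimpleGraph N) (C : Set (Sym2 N)) : Prop :=
  ∃ (x : N) (w : Γ.Walk x x), w.IsCycle ∧ C = {e | e ∈ w.edges}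

/-- A cycle double cover: a collection of cycles such that every edge lies on exactly two. -/
def IsCycleDoubleCover {N : Type u} (Γ : SimpleGraph N) (𝒞 : Set (Set (Sym2 N))) : Prop :=
  (∀ C ∈ 𝒞, IsCycleEdgeSet Γ C) ∧ ∀ e ∈ Γ.edgeSet, {C | C ∈ 𝒞 ∧ e ∈ C}.ncard = 2

/-- Every node has exactly three neighbours. -/
def IsCubic {N : Type u} (Γ : SimpleGraph N) : Prop :=
  ∀ x : N, (Γ.neighborSet x).ncard = 3

inductive Colour : Type
  | red
  | green
  | blue

/-- The cycles that avoid one of the three colours. For a proper edge colouring `c` these are the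
cycles whose edges alternate between two colours. -/
def bicolouredCycles {N : Type u} (Γ : SimpleGraph N) (c : Γ.edgeSet → Colour) :
    Set (Set (Sym2 N)) :=
  {C | IsCycleEdgeSet Γ C ∧ ∃ k : Colour, ∀ e : Γ.edgeSet, (e : Sym2 N) ∈ C → c e ≠ k}

/-- Number of nodes per group element: 6 for two generators, `2n + 6` for `n > 2`. -/
def fruchtNum (n : ℕ) : ℕ := if n = 2 then 6 else 2 * n + 6

/-- The node `(i, h)` is `x_{i,h}`, where `1 ≤ i ≤ 6` resp. `1 ≤ i ≤ 2n + 6`. -/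
abbrev FruchtNode (n : ℕ) (G : Type u) : Type u := {i : ℕ // 1 ≤ i ∧ i ≤ fruchtNum n} × G

/-- `(i, j) ∈ simpQ k`: for two generators, the edges `x_{i,h} x_{j,h}` have colour `k`. -/
def simpQ : Colour → Set (ℕ × ℕ)
  | Colour.red => {(2, 1)}
  | Colour.green => {(2, 3), (1, 4), (5, 6)}
  | Colour.blue => {(1, 3), (2, 6), (4, 5)}

/-- `(i, j) ∈ modQ n k`: for `n > 2` generators, the edges `x_{i,h} x_{j,h}` have colour `k`. -/
def modQ (n : ℕ) : Colour → Set (ℕ × ℕ)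
  | Colour.red => {(1, 6), (2, 3), (4, 5)}
  | Colour.green => {(1, 2), (3, 7), (4, 6), (5, 8)} ∪
      {p | ∃ i, 2 ≤ i ∧ i ≤ n ∧ p = (2 * i + 5, 2 * i + 6)}
  | Colour.blue => {(1, 3), (2, 4), (5, 7), (6, 2 * n + 6)} ∪
      {p | ∃ i, 2 ≤ i ∧ i ≤ n ∧ p = (2 * i + 4, 2 * i + 5)}

def fruchtQ (n : ℕ) : Colour → Set (ℕ × ℕ) := if n = 2 then simpQ else modQ n

/-- The `j`-th generator gives the red edges `x_{2j+1,h} x_{2j+2,h g_j}` for `n = 2` and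
`x_{2j+5,h} x_{2j+6,h g_j}` for `n > 2`. -/
def fruchtShift (n : ℕ) : ℕ := if n = 2 then 1 else 5

/-- The edges of colour `k`. The generators are `g 0, …, g (n - 1)`, so the index of `g j` in the
usual numbering is `j + 1`. -/
def fruchtEdges {G : Type u} [Group G] {n : ℕ} (g : Fin n → G) (k : Colour) :
    Set (Sym2 (FruchtNode n G)) :=
  {e | ∃ x y : FruchtNode n G, e = s(x, y) ∧
    ((((x.1 : ℕ), (y.1 : ℕ)) ∈ fruchtQ n k ∧ y.2 = x.2) ∨
     (k = Colour.red ∧ ∃ j : Fin n,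
        (x.1 : ℕ) = 2 * ((j : ℕ) + 1) + fruchtShift n ∧
        (y.1 : ℕ) = 2 * ((j : ℕ) + 1) + fruchtShift n + 1 ∧ y.2 = x.2 * g j))}

/-- The graph `Γ_{G,S}` for the generators `S = {g_1, …, g_n}`. -/
def fruchtGraph {G : Type u} [Group G] {n : ℕ} (g : Fin n → G) : SimpleGraph (FruchtNode n G) :=
  SimpleGraph.fromEdgeSet (⋃ k, fruchtEdges g k)

/-- The permutation `x_{i,h} ↦ x_{i,mh}` of the nodes. -/
def fruchtTranslate {G : Type u} [Group G] (n : ℕ) (m : G) (x : FruchtNode n G) :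
    FruchtNode n G := (x.1, m * x.2)

set_option linter.unusedSectionVars false

/-! A properly 3-edge-coloured cubic graph amounts to three fixed point free involutions that
disagree everywhere (`TriInvolution`). Deleting one colour leaves a 2-regular graph, so in the
finite case the bicoloured cycles are exactly the components of the three graphs `avoid k`
(`mem_bicolouredCycles_iff`). An edge of colour `k` lies on the two cycles at its ends that miss
another colour, which gives the double cover. With nodes as faces and bicoloured cycles as vertices
this is a closed simplicial surface; at each face, the vertex that misses `k` is opposite the edge
of colour `k`.

An automorphism permutes the three colours at every face. Crossing an edge preserves this
permutation, because the edge and its two vertices are shared by both faces and a cycle knows which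
colour it misses. On a connected surface the permutation is therefore one global `τ`, and
automorphisms come from node maps `φ` that intertwine the involutions up to `τ` (`exists_node_map`).
If every such pair has `τ = id` and agrees at one node with a translation by `G`, then connectedness
makes it that translation everywhere (`exists_mulEquiv_Aut`).

The graphs in (b) are voltage coverings with fibre `G` of a small coloured base graph, and left
multiplication commutes with the right multiplication by voltages. They are connected because edges
of trivial voltage connect each layer while the remaining red edges realise the generators. Rigidity
is tested with colour words that return to the node with index 1: the recoloured words must return
to its image. For `n > 2` the base graph alone leaves only `τ = id` and index 1. For `n = 2` it has
further solutions, which the voltages and one extra word exclude.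

For (a), a nontrivial group uses the construction for `n > 2`, which tolerates repeated generators;
the trivial group uses an asymmetric coloured graph on ten nodes. -/

instance : DecidableEq Colour := fun a b => by
  cases a <;> cases b <;> first | exact isTrue rfl | exact isFalse (by intro h; cases h)

instance : Fintype Colour := ⟨{Colour.red, Colour.green, Colour.blue}, by intro k; cases k <;> simp⟩

theorem Colour.exists_other (k : Colour) :
    ∃ a b : Colour, a ≠ b ∧ ∀ c, c ≠ k ↔ c = a ∨ c = b := by
  revert k; decide

/-! ### Three-edge-coloured cubic graphs and their bicoloured cycles -/

/-- A cubic graph with a proper 3-edge-colouring, given by the three fixed point free involutions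
`s k` which map a node to its neighbour along the edge of colour `k`. -/
structure TriInvolution (N : Type u) where
  s : Colour → N → N
  invol : ∀ k x, s k (s k x) = x
  ne_self : ∀ k x, s k x ≠ x
  inj : ∀ {k l x}, s k x = s l x → k = l

namespace TriInvolution

variable {N : Type u} (T : TriInvolution N)

/-- The nodes are connected by the edges. -/
def Connected : Prop :=
  ∀ P : N → Prop, (∀ k x, P x → P (T.s k x)) → ∀ x y, P x → P y

/-- The edges of colour `k`. -/
def colourEdges (k : Colour) : Set (Sym2 N) := {e | ∃ x, e = s(x, T.s k x)}

/-- The underlying graph. -/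
def graph : SimpleGraph N := SimpleGraph.fromEdgeSet (⋃ k, T.colourEdges k)

theorem mk_mem_colourEdges {k : Colour} {x y : N} :
    s(x, y) ∈ T.colourEdges k ↔ y = T.s k x := by
  constructor
  · rintro ⟨z, hz⟩
    rcases Sym2.eq_iff.1 hz with ⟨rfl, rfl⟩ | ⟨rfl, rfl⟩
    · rfl
    · rw [T.invol]
  · rintro rfl
    exact ⟨x, rfl⟩

theorem graph_adj {x y : N} : T.graph.Adj x y ↔ ∃ k, y = T.s k x := by
  rw [graph, SimpleGraph.fromEdgeSet_adj, Set.mem_iUnion]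
  simp only [mk_mem_colourEdges]
  constructor
  · exact fun h => h.1
  · rintro ⟨k, rfl⟩
    exact ⟨⟨k, rfl⟩, (T.ne_self k x).symm⟩

theorem mem_edgeSet {e : Sym2 N} : e ∈ T.graph.edgeSet ↔ ∃ k x, e = s(x, T.s k x) := by
  induction e with
  | h x y =>
    rw [SimpleGraph.mem_edgeSet, graph_adj]
    constructor
    · rintro ⟨k, rfl⟩
      exact ⟨k, x, rfl⟩
    · rintro ⟨k, z, h⟩
      exact ⟨k, T.mk_mem_colourEdges.1 ⟨z, h⟩⟩

theorem s_mem_edgeSet (k : Colour) (x : N) : s(x, T.s k x) ∈ T.graph.edgeSet :=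
  T.mem_edgeSet.2 ⟨k, x, rfl⟩

theorem exists_mem_colourEdges {e : Sym2 N} (h : e ∈ T.graph.edgeSet) :
    ∃ k, e ∈ T.colourEdges k := by
  obtain ⟨k, x, rfl⟩ := T.mem_edgeSet.1 h
  exact ⟨k, x, rfl⟩

theorem colour_unique {e : Sym2 N} {k l : Colour} (hk : e ∈ T.colourEdges k)
    (hl : e ∈ T.colourEdges l) : k = l := by
  obtain ⟨x, rfl⟩ := hk
  exact T.inj (T.mk_mem_colourEdges.1 hl)

theorem eq_s_of_mem {e : Sym2 N} {k : Colour} {x : N} (h : e ∈ T.colourEdges k) (hx : x ∈ e) :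
    e = s(x, T.s k x) := by
  obtain ⟨z, rfl⟩ := h
  rcases Sym2.mem_iff.1 hx with rfl | rfl
  · rfl
  · rw [T.invol, Sym2.eq_swap]

theorem neighborSet_eq (x : N) : T.graph.neighborSet x = Set.range (fun k => T.s k x) := by
  ext y
  rw [SimpleGraph.mem_neighborSet, graph_adj]
  simp [eq_comm]

theorem isCubic : IsCubic T.graph := by
  intro x
  rw [neighborSet_eq, ← Set.image_univ, Set.ncard_image_of_injective _ (fun _ _ h => T.inj h),
    Set.ncard_univ, Nat.card_eq_fintype_card]
  rfl

/-- The colour of an edge. -/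
noncomputable def colour (e : T.graph.edgeSet) : Colour :=
  (T.exists_mem_colourEdges e.2).choose

theorem colour_eq_iff (e : T.graph.edgeSet) (k : Colour) :
    T.colour e = k ↔ (e : Sym2 N) ∈ T.colourEdges k := by
  have h := (T.exists_mem_colourEdges e.2).choose_spec
  exact ⟨fun hk => hk ▸ h, fun hk => T.colour_unique h hk⟩

/-- The colours as a colouring of the line graph. -/
noncomputable def coloring : T.graph.lineGraph.Coloring Colour :=
  SimpleGraph.Coloring.mk T.colour (by
    intro e f hef hc
    obtain ⟨hne, x, hxe, hxf⟩ := SimpleGraph.lineGraph_adj_iff_exists.1 hef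
    have he := (T.colour_eq_iff e _).1 rfl
    have hf := (T.colour_eq_iff f _).1 hc.symm
    exact hne (Subtype.ext ((T.eq_s_of_mem he hxe).trans (T.eq_s_of_mem hf hxf).symm)))

theorem coloring_eq_iff (e : T.graph.edgeSet) (k : Colour) :
    T.coloring e = k ↔ (e : Sym2 N) ∈ T.colourEdges k := T.colour_eq_iff e k

/-- The subgraph of the edges whose colour is not `k`. -/
def avoid (k : Colour) : SimpleGraph N :=
  SimpleGraph.fromEdgeSet {e | ∃ l, l ≠ k ∧ e ∈ T.colourEdges l}

theorem avoid_adj {k : Colour} {x y : N} : (T.avoid k).Adj x y ↔ ∃ l, l ≠ k ∧ y = T.s l x := by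
  rw [avoid, SimpleGraph.fromEdgeSet_adj, Set.mem_ofPred_eq]
  simp only [mk_mem_colourEdges]
  constructor
  · exact fun h => h.1
  · rintro ⟨l, hl, rfl⟩
    exact ⟨⟨l, hl, rfl⟩, (T.ne_self l x).symm⟩

theorem avoid_le (k : Colour) : T.avoid k ≤ T.graph := by
  intro x y h
  obtain ⟨l, -, rfl⟩ := T.avoid_adj.1 h
  exact T.graph_adj.2 ⟨l, rfl⟩

theorem avoid_neighborSet {k a b : Colour} (h : ∀ c, c ≠ k ↔ c = a ∨ c = b) (x : N) :
    (T.avoid k).neighborSet x = {T.s a x, T.s b x} := by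
  ext y
  rw [SimpleGraph.mem_neighborSet, avoid_adj]
  simp [h]

theorem isCycles_avoid (k : Colour) : (T.avoid k).IsCycles := by
  intro x _
  obtain ⟨a, b, hab, h⟩ := k.exists_other
  rw [T.avoid_neighborSet h]
  exact Set.ncard_pair fun h => hab (T.inj h)

theorem avoid_neighborSet_nonempty (k : Colour) (x : N) :
    ((T.avoid k).neighborSet x).Nonempty := by
  obtain ⟨a, b, hab, h⟩ := k.exists_other
  rw [T.avoid_neighborSet h]
  simp

/-- The edge set of the cycle through `x` that avoids the colour `k`. -/
def cyc (k : Colour) (x : N) : Set (Sym2 N) :=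
  {e | ∃ y l, l ≠ k ∧ (T.avoid k).Reachable x y ∧ e = s(y, T.s l y)}

theorem reachable_s {k l : Colour} (h : l ≠ k) (x : N) : (T.avoid k).Reachable x (T.s l x) :=
  (T.avoid_adj.2 ⟨l, h, rfl⟩).reachable

theorem reachable_s_iff {k l : Colour} (h : l ≠ k) {x y : N} :
    (T.avoid k).Reachable x (T.s l y) ↔ (T.avoid k).Reachable x y :=
  ⟨fun hr => hr.trans (T.reachable_s h y).symm, fun hr => hr.trans (T.reachable_s h y)⟩

theorem mk_mem_cyc {k l : Colour} {x y : N} :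
    s(y, T.s l y) ∈ T.cyc k x ↔ l ≠ k ∧ (T.avoid k).Reachable x y := by
  constructor
  · rintro ⟨z, m, hm, hr, he⟩
    obtain rfl : l = m := T.colour_unique ⟨y, rfl⟩ ⟨z, he⟩
    refine ⟨hm, ?_⟩
    rcases Sym2.eq_iff.1 he with ⟨rfl, -⟩ | ⟨rfl, -⟩
    · exact hr
    · exact (T.reachable_s_iff hm).2 hr
  · rintro ⟨hl, hr⟩
    exact ⟨y, l, hl, hr, rfl⟩

theorem cyc_congr {k : Colour} {x y : N} (h : (T.avoid k).Reachable x y) :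
    T.cyc k x = T.cyc k y := by
  ext e
  exact ⟨fun ⟨z, l, hl, hr, he⟩ => ⟨z, l, hl, h.symm.trans hr, he⟩,
    fun ⟨z, l, hl, hr, he⟩ => ⟨z, l, hl, h.trans hr, he⟩⟩

/-- Since two colours remain at every node, passing from a component of `avoid k` to its edges loses
no node. This identifies the faces at a vertex. -/
theorem exists_mem_cyc_iff {k : Colour} {x y : N} :
    (∃ e ∈ T.cyc k x, y ∈ e) ↔ (T.avoid k).Reachable x y := by
  constructor
  · rintro ⟨_, ⟨z, l, hl, hr, rfl⟩, hy⟩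
    rcases Sym2.mem_iff.1 hy with rfl | rfl
    · exact hr
    · exact (T.reachable_s_iff hl).2 hr
  · intro h
    obtain ⟨a, b, -, hab⟩ := k.exists_other
    exact ⟨_, T.mk_mem_cyc.2 ⟨(hab a).2 (Or.inl rfl), h⟩, Sym2.mem_mk_left _ _⟩

/-- A bicoloured cycle contains edges of both colours other than the missing one, so the edge set
determines which colour is missing. -/
theorem cyc_inj {k l : Colour} {x y : N} (h : T.cyc k x = T.cyc l y) : k = l := by
  by_contra hkl
  have h1 : s(x, T.s l x) ∈ T.cyc k x := T.mk_mem_cyc.2 ⟨Ne.symm hkl, .refl x⟩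
  rw [h] at h1
  exact (T.mk_mem_cyc.1 h1).1 rfl

/-- In a 2-regular graph a cycle uses both edges at each of its nodes. Its support is thus closed
under adjacency and fills the whole component. -/
theorem edges_eq_cyc [Finite N] {k : Colour} {x : N} {w : (T.avoid k).Walk x x}
    (hw : w.IsCycle) : {e | e ∈ w.edges} = T.cyc k x := by
  classical
  have : (T.avoid k).LocallyFinite := fun v => Fintype.ofFinite _
  have key : ∀ y ∈ w.support, ∀ z, (T.avoid k).Adj y z → s(y, z) ∈ w.edges := by
    intro y hy z hz
    rw [← SimpleGraph.Walk.adj_toSubgraph_iff_mem_edges]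
    exact (hw.adj_toSubgraph_iff_of_isCycles (T.isCycles_avoid k)
      ((w.mem_verts_toSubgraph).2 hy) z).2 hz
  have supp : ∀ y, (T.avoid k).Reachable x y → y ∈ w.support := by
    rintro y ⟨p⟩
    have : ∀ a b (p : (T.avoid k).Walk a b), a ∈ w.support → b ∈ w.support := by
      intro a b p
      induction p with
      | nil => exact id
      | cons h p ih => exact fun ha => ih (w.snd_mem_support_of_mem_edges (key _ ha _ h))
    exact this _ _ p w.start_mem_support
  ext e
  constructor
  · intro he
    induction e with
    | h y z =>
      obtain ⟨l, hl, rfl⟩ := T.avoid_adj.1 (w.adj_of_mem_edges he)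
      exact T.mk_mem_cyc.2 ⟨hl, ⟨w.takeUntil y (w.fst_mem_support_of_mem_edges he)⟩⟩
  · rintro ⟨y, l, hl, hr, rfl⟩
    exact key y (supp y hr) _ (T.avoid_adj.2 ⟨l, hl, rfl⟩)

theorem mem_bicolouredCycles_iff [Finite N] {C : Set (Sym2 N)} :
    C ∈ bicolouredCycles T.graph T.coloring ↔ ∃ k x, C = T.cyc k x := by
  constructor
  · rintro ⟨⟨x, w, hw, rfl⟩, k, hk⟩
    -- A cycle of the full graph without colour `k` can be transferred to `avoid k`, where
    -- 2-regularity applies.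
    have ht : ∀ e ∈ w.edges, e ∈ (T.avoid k).edgeSet := by
      intro e he
      have hG := w.edges_subset_edgeSet he
      have hc := hk ⟨e, hG⟩ he
      have hm := (T.coloring_eq_iff ⟨e, hG⟩ _).1 rfl
      obtain ⟨z, hz⟩ := id hm
      change e = _ at hz
      rw [hz, SimpleGraph.mem_edgeSet]
      exact T.avoid_adj.2 ⟨_, hc, rfl⟩
    refine ⟨k, x, ?_⟩
    rw [← T.edges_eq_cyc (hw.transfer ht)]
    simp
  · rintro ⟨k, x, rfl⟩
    obtain ⟨p, hp, -⟩ := (T.isCycles_avoid k).exists_cycle_toSubgraph_verts_eq_connectedComponentSupp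
      (c := (T.avoid k).connectedComponentMk x) (v := x) rfl (T.avoid_neighborSet_nonempty k x)
    refine ⟨⟨x, p.mapLe (T.avoid_le k), hp.mapLe _, ?_⟩, k, ?_⟩
    · rw [SimpleGraph.Walk.edges_mapLe_eq_edges, T.edges_eq_cyc hp]
    · rintro ⟨e, he⟩ ⟨y, l, hl, -, rfl⟩ hc
      exact hl (T.colour_unique ⟨y, rfl⟩ ((T.coloring_eq_iff _ _).1 hc))

theorem setOf_mem_cycle_eq [Finite N] {k : Colour} {x : N} :
    {C | C ∈ bicolouredCycles T.graph T.coloring ∧ s(x, T.s k x) ∈ C} =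
      (fun l => T.cyc l x) '' {l | l ≠ k} := by
  ext C
  constructor
  · rintro ⟨hC, he⟩
    obtain ⟨l, y, rfl⟩ := T.mem_bicolouredCycles_iff.1 hC
    have := T.mk_mem_cyc.1 he
    exact ⟨l, this.1.symm, (T.cyc_congr this.2).symm⟩
  · rintro ⟨l, hl, rfl⟩
    exact ⟨T.mem_bicolouredCycles_iff.2 ⟨l, x, rfl⟩, T.mk_mem_cyc.2 ⟨Ne.symm hl, .refl x⟩⟩

theorem cyc_injective (x : N) : Function.Injective fun l => T.cyc l x := fun _ _ h => T.cyc_inj h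

theorem isCycleDoubleCover [Finite N] :
    IsCycleDoubleCover T.graph (bicolouredCycles T.graph T.coloring) := by
  refine ⟨fun C hC => hC.1, fun e he => ?_⟩
  obtain ⟨k, x, rfl⟩ := T.mem_edgeSet.1 he
  rw [setOf_mem_cycle_eq, Set.ncard_image_of_injective _ (T.cyc_injective x)]
  obtain ⟨a, b, hab, h⟩ := k.exists_other
  have : {l | l ≠ k} = {a, b} := by ext c; exact h c
  rw [this, Set.ncard_pair hab]

theorem reachable_map {φ : N → N} {τ : Colour → Colour} (hτ : Function.Injective τ)
    (hφ : ∀ k x, φ (T.s k x) = T.s (τ k) (φ x)) {k : Colour} {x y : N}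
    (h : (T.avoid k).Reachable x y) : (T.avoid (τ k)).Reachable (φ x) (φ y) := by
  obtain ⟨p⟩ := h
  induction p with
  | nil => exact .refl _
  | cons h p ih =>
    obtain ⟨l, hl, rfl⟩ := T.avoid_adj.1 h
    refine SimpleGraph.Reachable.trans ?_ ih
    rw [hφ]
    exact T.reachable_s (fun h => hl (hτ h)) _

theorem map_s {φ : N → N} (hφ : ∀ k x, φ (T.s k x) = T.s k (φ x)) (k : Colour) (x : N) :
    Sym2.map φ s(x, T.s k x) = s(φ x, T.s k (φ x)) := by
  rw [Sym2.map_mk, hφ]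

theorem image_colourEdges {φ : N → N} (hs : Function.Surjective φ)
    (hφ : ∀ k x, φ (T.s k x) = T.s k (φ x)) (k : Colour) :
    Sym2.map φ '' T.colourEdges k = T.colourEdges k := by
  ext e
  constructor
  · rintro ⟨_, ⟨x, rfl⟩, rfl⟩
    exact ⟨φ x, T.map_s hφ k x⟩
  · rintro ⟨x, rfl⟩
    obtain ⟨y, rfl⟩ := hs x
    exact ⟨_, ⟨y, rfl⟩, T.map_s hφ k y⟩

theorem image_cyc {φ ψ : N → N} (hr : ∀ x, φ (ψ x) = x) (hl : ∀ x, ψ (φ x) = x)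
    (hφ : ∀ k x, φ (T.s k x) = T.s k (φ x)) (k : Colour) (x : N) :
    Sym2.map φ '' T.cyc k x = T.cyc k (φ x) := by
  -- The inverse preserves colours as well; it is needed to pull reachability back along `φ`.
  have hψ : ∀ k x, ψ (T.s k x) = T.s k (ψ x) := by
    intro k x
    rw [← hl (T.s k (ψ x)), hφ, hr]
  ext e
  constructor
  · rintro ⟨_, ⟨y, l, hl, h, rfl⟩, rfl⟩
    exact ⟨φ y, l, hl, T.reachable_map (τ := id) Function.injective_id hφ h, T.map_s hφ l y⟩
  · rintro ⟨y, l, hkl, h, rfl⟩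
    refine ⟨s(ψ y, T.s l (ψ y)), ⟨ψ y, l, hkl, ?_, rfl⟩, ?_⟩
    · have := T.reachable_map (τ := id) Function.injective_id hψ h
      rwa [hl] at this
    · rw [T.map_s hφ, hr]

end TriInvolution

/-! ### The simplicial surface of a coloured cubic graph -/

/-- A closed walk which is a cycle arranges its nodes in a cyclic sequence. -/
theorem SimpleGraph.Walk.IsCycle.exists_cyclic_sequence {N : Type u} {Γ : SimpleGraph N} {x : N}
    {w : Γ.Walk x x} (hw : w.IsCycle) :
    ∃ (n : ℕ) (U : ZMod n → N), 3 ≤ n ∧ Function.Injective U ∧ Set.range U = {y | y ∈ w.support} ∧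
      ∀ i : ZMod n, s(U i, U (i + 1)) ∈ w.edges := by
  have h3 := hw.three_le_length
  have : NeZero w.length := ⟨by omega⟩
  have hinj := hw.getVert_injOn'
  refine ⟨w.length, fun i => w.getVert i.val, h3, ?_, ?_, ?_⟩
  · intro i j hij
    have hi := ZMod.val_lt i
    have hj := ZMod.val_lt j
    exact ZMod.val_injective _ (hinj (show i.val ≤ w.length - 1 by omega)
      (show j.val ≤ w.length - 1 by omega) hij)
  · ext y
    constructor
    · rintro ⟨i, rfl⟩
      exact w.getVert_mem_support _
    · intro hy
      obtain ⟨m, rfl, hm⟩ := SimpleGraph.Walk.mem_support_iff_exists_getVert.1 hy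
      rcases hm.lt_or_eq with hm | rfl
      · exact ⟨m, by simp only [ZMod.val_natCast, Nat.mod_eq_of_lt hm]⟩
      · exact ⟨0, by simp⟩
  · intro i
    have hi := ZMod.val_lt i
    have : Fact (1 < w.length) := ⟨by omega⟩
    -- Only at the last index does addition wrap around; there both sides are the base point of the
    -- closed walk.
    have h1 : w.getVert (i + 1).val = w.getVert (i.val + 1) := by
      rw [ZMod.val_add, ZMod.val_one]
      rcases (Nat.succ_le_of_lt hi).lt_or_eq with h | h
      · rw [Nat.mod_eq_of_lt h]
      · rw [show i.val + 1 = w.length from h]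
        simp
    change s(w.getVert i.val, w.getVert (i + 1).val) ∈ w.edges
    rw [h1, ← SimpleGraph.Walk.adj_toSubgraph_iff_mem_edges]
    exact w.toSubgraph_adj_getVert hi


namespace TriInvolution

variable {N : Type u} [Finite N] (T : TriInvolution N)

/-- The vertices, edges and faces of the surface. -/
abbrev Cell : Type u := bicolouredCycles T.graph T.coloring ⊕ (T.graph.edgeSet ⊕ N)

/-- The vertex that lies on the edges at the face `x` whose colour is not `k`. -/
def vert (k : Colour) (x : N) : T.Cell :=
  Sum.inl ⟨T.cyc k x, T.mem_bicolouredCycles_iff.2 ⟨k, x, rfl⟩⟩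

/-- The edge of colour `k` at the face `x`. -/
def edge (k : Colour) (x : N) : T.Cell := Sum.inr (Sum.inl ⟨s(x, T.s k x), T.s_mem_edgeSet k x⟩)

/-- The face `x`. -/
def face (x : N) : T.Cell := Sum.inr (Sum.inr x)

/-- The incidence relation of the surface. -/
def lt : T.Cell → T.Cell → Prop
  | Sum.inl V, Sum.inr (Sum.inl e) => (e : Sym2 N) ∈ (V : Set (Sym2 N))
  | Sum.inl V, Sum.inr (Sum.inr x) => ∃ d ∈ (V : Set (Sym2 N)), x ∈ d
  | Sum.inr (Sum.inl e), Sum.inr (Sum.inr x) => x ∈ (e : Sym2 N)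
  | _, _ => False

def verts : Set T.Cell := Set.range Sum.inl
def edges : Set T.Cell := Set.range fun e => Sum.inr (Sum.inl e)
def faces : Set T.Cell := Set.range fun x => Sum.inr (Sum.inr x)

variable {T}

theorem vert_inj {k l : Colour} {x y : N} :
    T.vert k x = T.vert l y ↔ k = l ∧ (T.avoid k).Reachable x y := by
  constructor
  · intro h
    have h : T.cyc k x = T.cyc l y := congrArg Subtype.val (Sum.inl_injective h)
    obtain rfl := T.cyc_inj h
    exact ⟨rfl, T.exists_mem_cyc_iff.1 (h ▸ T.exists_mem_cyc_iff.2 (.refl y))⟩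
  · rintro ⟨rfl, h⟩
    exact congrArg Sum.inl (Subtype.ext (T.cyc_congr h))

theorem edge_inj {k l : Colour} {x y : N} :
    T.edge k x = T.edge l y ↔ s(x, T.s k x) = s(y, T.s l y) := by
  simp [edge]

theorem edge_left_inj {k l : Colour} {x : N} : T.edge k x = T.edge l x ↔ k = l := by
  rw [edge_inj]
  exact ⟨fun h => T.colour_unique ⟨x, rfl⟩ ⟨x, h⟩, fun h => by rw [h]⟩

theorem face_inj {x y : N} : T.face x = T.face y ↔ x = y := by simp [face]

theorem edge_s (k : Colour) (x : N) : T.edge k (T.s k x) = T.edge k x := by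
  rw [edge_inj, T.invol, Sym2.eq_swap]

theorem vert_s {k l : Colour} (h : l ≠ k) (x : N) : T.vert k (T.s l x) = T.vert k x :=
  vert_inj.2 ⟨rfl, (T.reachable_s h x).symm⟩

theorem vert_mem (k : Colour) (x : N) : T.vert k x ∈ T.verts := ⟨_, rfl⟩
theorem edge_mem (k : Colour) (x : N) : T.edge k x ∈ T.edges := ⟨_, rfl⟩
theorem face_mem (x : N) : T.face x ∈ T.faces := ⟨_, rfl⟩

theorem exists_vert {V : T.Cell} (h : V ∈ T.verts) : ∃ k x, V = T.vert k x := by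
  obtain ⟨⟨C, hC⟩, rfl⟩ := h
  obtain ⟨k, x, rfl⟩ := T.mem_bicolouredCycles_iff.1 hC
  exact ⟨k, x, rfl⟩

theorem exists_edge {e : T.Cell} (h : e ∈ T.edges) : ∃ k x, e = T.edge k x := by
  obtain ⟨⟨e, he⟩, rfl⟩ := h
  obtain ⟨k, x, rfl⟩ := T.mem_edgeSet.1 he
  exact ⟨k, x, rfl⟩

theorem exists_face {F : T.Cell} (h : F ∈ T.faces) : ∃ x, F = T.face x := by
  obtain ⟨x, rfl⟩ := h
  exact ⟨x, rfl⟩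

/-- Every cell has the form `vert k x`, `edge k x` or `face x`, so from here on incidence is a
matter of colours and reachability only. -/
theorem vert_lt_edge {k l : Colour} {x y : N} :
    T.lt (T.vert k x) (T.edge l y) ↔ l ≠ k ∧ (T.avoid k).Reachable x y := T.mk_mem_cyc

theorem vert_lt_face {k : Colour} {x y : N} :
    T.lt (T.vert k x) (T.face y) ↔ (T.avoid k).Reachable x y := T.exists_mem_cyc_iff

theorem edge_lt_face {k : Colour} {x y : N} :
    T.lt (T.edge k x) (T.face y) ↔ y = x ∨ y = T.s k x := Sym2.mem_iff

theorem eq_edge_of_lt_face {k : Colour} {x y : N} (h : T.lt (T.edge k x) (T.face y)) :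
    T.edge k x = T.edge k y := by
  rcases edge_lt_face.1 h with rfl | rfl
  · rfl
  · rw [edge_s]

theorem lt_type {A B : T.Cell} (h : T.lt A B) :
    (A ∈ T.verts ∧ B ∈ T.edges) ∨ (A ∈ T.edges ∧ B ∈ T.faces) ∨
      (A ∈ T.verts ∧ B ∈ T.faces) := by
  rcases A with A | A | A <;> rcases B with B | B | B <;>
    simp [lt, verts, edges, faces] at h ⊢

theorem setOf_vert_lt_edge (k : Colour) (x : N) :
    {V | V ∈ T.verts ∧ T.lt V (T.edge k x)} = (fun l => T.vert l x) '' {l | l ≠ k} := by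
  ext V
  constructor
  · rintro ⟨hV, h⟩
    obtain ⟨l, y, rfl⟩ := exists_vert hV
    obtain ⟨hl, hr⟩ := vert_lt_edge.1 h
    exact ⟨l, hl.symm, vert_inj.2 ⟨rfl, hr.symm⟩⟩
  · rintro ⟨l, hl, rfl⟩
    exact ⟨vert_mem _ _, vert_lt_edge.2 ⟨Ne.symm hl, .refl x⟩⟩

theorem setOf_vert_lt_face (x : N) :
    {V | V ∈ T.verts ∧ T.lt V (T.face x)} = Set.range fun l => T.vert l x := by
  ext V
  constructor
  · rintro ⟨hV, h⟩
    obtain ⟨l, y, rfl⟩ := exists_vert hV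
    exact ⟨l, vert_inj.2 ⟨rfl, (vert_lt_face.1 h).symm⟩⟩
  · rintro ⟨l, rfl⟩
    exact ⟨vert_mem _ _, vert_lt_face.2 (.refl x)⟩

theorem setOf_edge_lt_face (x : N) :
    {e | e ∈ T.edges ∧ T.lt e (T.face x)} = Set.range fun l => T.edge l x := by
  ext V
  constructor
  · rintro ⟨hV, h⟩
    obtain ⟨l, y, rfl⟩ := exists_edge hV
    exact ⟨l, (eq_edge_of_lt_face h).symm⟩
  · rintro ⟨l, rfl⟩
    exact ⟨edge_mem _ _, edge_lt_face.2 (Or.inl rfl)⟩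

theorem setOf_corner (k : Colour) (x : N) :
    {e | e ∈ T.edges ∧ T.lt (T.vert k x) e ∧ T.lt e (T.face x)} =
      (fun l => T.edge l x) '' {l | l ≠ k} := by
  ext V
  constructor
  · rintro ⟨hV, h, h'⟩
    obtain ⟨l, y, rfl⟩ := exists_edge hV
    exact ⟨l, (vert_lt_edge.1 h).1, (eq_edge_of_lt_face h').symm⟩
  · rintro ⟨l, hl, rfl⟩
    exact ⟨edge_mem _ _, vert_lt_edge.2 ⟨hl, .refl x⟩, edge_lt_face.2 (Or.inl rfl)⟩

theorem setOf_face_gt_edge (k : Colour) (x : N) :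
    {F | F ∈ T.faces ∧ T.lt (T.edge k x) F} = {T.face x, T.face (T.s k x)} := by
  ext V
  constructor
  · rintro ⟨hV, h⟩
    obtain ⟨y, rfl⟩ := exists_face hV
    rcases edge_lt_face.1 h with rfl | rfl <;> simp
  · rintro (rfl | rfl)
    · exact ⟨face_mem _, edge_lt_face.2 (Or.inl rfl)⟩
    · exact ⟨face_mem _, edge_lt_face.2 (Or.inr rfl)⟩

theorem vert_injective (x : N) : Function.Injective fun l => T.vert l x :=
  fun _ _ h => (vert_inj.1 h).1

theorem edge_injective (x : N) : Function.Injective fun l => T.edge l x :=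
  fun _ _ h => edge_left_inj.1 h

theorem ncard_range_colour {β : Type*} {f : Colour → β} (hf : Function.Injective f) :
    (Set.range f).ncard = 3 := by
  rw [← Set.image_univ, Set.ncard_image_of_injective _ hf, Set.ncard_univ,
    Nat.card_eq_fintype_card]
  rfl

theorem ncard_image_colour {β : Type*} {f : Colour → β} (hf : Function.Injective f) (k : Colour) :
    (f '' {l | l ≠ k}).ncard = 2 := by
  obtain ⟨a, b, hab, h⟩ := k.exists_other
  have : {c | c ≠ k} = {a, b} := Set.ext h
  rw [Set.ncard_image_of_injective _ hf, this, Set.ncard_pair hab]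

variable (T)

/-- The surface whose face graph is `T.graph` and whose vertices are the bicoloured cycles. -/
def surface [Nonempty N] : SimplicialSurface T.Cell where
  X0 := T.verts
  X1 := T.edges
  X2 := T.faces
  lt := T.lt
  countable := inferInstance
  X0_nonempty := ⟨_, vert_mem Colour.red (Classical.arbitrary N)⟩
  X1_nonempty := ⟨_, edge_mem Colour.red (Classical.arbitrary N)⟩
  X2_nonempty := ⟨_, face_mem (Classical.arbitrary N)⟩
  union_eq := by
    ext A
    rcases A with A | A | A <;> simp [verts, edges, faces]
  disjoint01 := by
    rw [Set.disjoint_left]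
    rintro _ ⟨A, rfl⟩ ⟨B, hB⟩
    cases hB
  disjoint02 := by
    rw [Set.disjoint_left]
    rintro _ ⟨A, rfl⟩ ⟨B, hB⟩
    cases hB
  disjoint12 := by
    rw [Set.disjoint_left]
    rintro _ ⟨A, rfl⟩ ⟨B, hB⟩
    cases hB
  lt_type _ _ h := lt_type h
  edge_vertices e he := by
    obtain ⟨k, x, rfl⟩ := exists_edge he
    rw [setOf_vert_lt_edge, ncard_image_colour (vert_injective x)]
  face_edges F hF := by
    obtain ⟨x, rfl⟩ := exists_face hF
    rw [setOf_edge_lt_face, ncard_range_colour (edge_injective x)]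
  face_vertices F hF := by
    obtain ⟨x, rfl⟩ := exists_face hF
    rw [setOf_vert_lt_face, ncard_range_colour (vert_injective x)]
  face_corner F hF V hV h := by
    obtain ⟨x, rfl⟩ := exists_face hF
    obtain ⟨k, y, rfl⟩ := exists_vert hV
    rw [(vert_inj (T := T)).2 ⟨rfl, vert_lt_face.1 h⟩, setOf_corner,
      ncard_image_colour (edge_injective x)]
  edge_faces e he := by
    obtain ⟨k, x, rfl⟩ := exists_edge he
    rw [setOf_face_gt_edge, Set.ncard_pair fun h => T.ne_self k x (face_inj.1 h).symm]
  umbrella V hV := by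
    obtain ⟨⟨C, hC⟩, rfl⟩ := hV
    obtain ⟨⟨x, w, hw, rfl⟩, -⟩ := id hC
    obtain ⟨n, U, hn, hinj, hrange, hU⟩ := hw.exists_cyclic_sequence
    refine ⟨n, fun i => T.face (U i), hn, fun i j h => hinj (face_inj.1 h), ?_, ?_⟩
    · ext F
      constructor
      · rintro ⟨i, rfl⟩
        exact ⟨face_mem _, _, hU i, Sym2.mem_mk_left _ _⟩
      · rintro ⟨hF, h⟩
        obtain ⟨y, rfl⟩ := exists_face hF
        obtain ⟨d, hd, hy⟩ := h
        have : y ∈ Set.range U := by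
          rw [hrange]
          exact w.mem_support_of_mem_edges hd hy
        obtain ⟨i, rfl⟩ := this
        exact ⟨i, rfl⟩
    · intro i
      exact ⟨Sum.inr (Sum.inl ⟨_, w.edges_subset_edgeSet (hU i)⟩), ⟨_, rfl⟩, hU i,
        Sym2.mem_mk_left _ _, Sym2.mem_mk_right _ _⟩

/-- The surface is the one given by `T.graph` and the bicoloured cycles. -/
noncomputable def coverIso [Nonempty N] :
    T.surface.CoverIso T.graph (bicolouredCycles T.graph T.coloring) where
  faceEquiv := (Equiv.ofInjective _ (Sum.inr_injective.comp Sum.inr_injective)).symm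
  edgeEquiv := (Equiv.ofInjective _ (Sum.inr_injective.comp Sum.inl_injective)).symm
  vertexEquiv := (Equiv.ofInjective _ Sum.inl_injective).symm
  edge_lt_face_iff := by
    rintro ⟨_, e, rfl⟩ ⟨_, x, rfl⟩
    erw [Equiv.ofInjective_symm_apply, Equiv.ofInjective_symm_apply]
    rfl
  vertex_lt_edge_iff := by
    rintro ⟨_, e, rfl⟩ ⟨_, x, rfl⟩
    erw [Equiv.ofInjective_symm_apply, Equiv.ofInjective_symm_apply]
    rfl
  vertex_lt_face_iff := by
    rintro ⟨_, e, rfl⟩ ⟨_, x, rfl⟩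
    erw [Equiv.ofInjective_symm_apply, Equiv.ofInjective_symm_apply]
    rfl

end TriInvolution

/-! ### Automorphisms of the surface -/

namespace SimplicialSurface

variable {α : Type u} {X : SimplicialSurface α}

/-- For a permutation that reflects incidence, the local condition at each face is automatic, for
the inverse too. -/
theorem mem_Aut_of_lt_iff {π : Equiv.Perm α} (h : ∀ A B, X.lt (π A) (π B) ↔ X.lt A B) :
    π ∈ X.Aut := by
  have key : ∀ π : Equiv.Perm α, (∀ A B, X.lt (π A) (π B) ↔ X.lt A B) → IsHom X X π := by
    intro π h
    refine ⟨fun A B => (h A B).2, fun F _ => ⟨fun A hA => (h A F).2 hA, π.injective.injOn, ?_⟩,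
      fun F _ A B _ _ => (h A B).symm⟩
    intro B hB
    refine ⟨π.symm B, ?_, π.apply_symm_apply B⟩
    rw [Set.mem_ofPred_eq, ← h, π.apply_symm_apply]
    exact hB
  refine ⟨key π h, key π.symm fun A B => ?_⟩
  rw [← h, π.apply_symm_apply, π.apply_symm_apply]

end SimplicialSurface

namespace TriInvolution

variable {N : Type u} [Finite N] {T : TriInvolution N}

theorem cell_cases (A : T.Cell) :
    (∃ k x, A = T.vert k x) ∨ (∃ k x, A = T.edge k x) ∨ ∃ x, A = T.face x := by
  rcases A with A | A | x
  · exact Or.inl (exists_vert ⟨A, rfl⟩)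
  · exact Or.inr (Or.inl (exists_edge ⟨A, rfl⟩))
  · exact Or.inr (Or.inr ⟨x, rfl⟩)

section CellMap

variable (φ : Equiv.Perm N) (hφ : ∀ k x, φ (T.s k x) = T.s k (φ x))

/-- The map of cells induced by a colour preserving permutation of the nodes. -/
def cellMap : T.Cell → T.Cell
  | Sum.inl C => Sum.inl ⟨Sym2.map φ '' C, by
      obtain ⟨k, x, hC⟩ := T.mem_bicolouredCycles_iff.1 C.2
      rw [hC, T.image_cyc φ.apply_symm_apply φ.symm_apply_apply hφ]
      exact T.mem_bicolouredCycles_iff.2 ⟨k, φ x, rfl⟩⟩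
  | Sum.inr (Sum.inl e) => Sum.inr (Sum.inl ⟨Sym2.map φ e, by
      obtain ⟨k, x, he⟩ := T.mem_edgeSet.1 e.2
      rw [he, T.map_s hφ]
      exact T.s_mem_edgeSet k (φ x)⟩)
  | Sum.inr (Sum.inr x) => Sum.inr (Sum.inr (φ x))

theorem cellMap_vert (k : Colour) (x : N) : cellMap φ hφ (T.vert k x) = T.vert k (φ x) :=
  congrArg Sum.inl
    (Subtype.ext (T.image_cyc φ.apply_symm_apply φ.symm_apply_apply hφ k x))

theorem cellMap_edge (k : Colour) (x : N) : cellMap φ hφ (T.edge k x) = T.edge k (φ x) :=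
  congrArg (fun e => Sum.inr (Sum.inl e)) (Subtype.ext (T.map_s hφ k x))

theorem cellMap_face (x : N) : cellMap φ hφ (T.face x) = T.face (φ x) := rfl

theorem cellMap_lt {A B : T.Cell} : T.lt (cellMap φ hφ A) (cellMap φ hφ B) ↔ T.lt A B := by
  have hinj := Sym2.map.injective φ.injective
  have hmem : ∀ (x : N) (e : Sym2 N), φ x ∈ Sym2.map φ e ↔ x ∈ e := by
    intro x e
    rw [Sym2.mem_map]
    exact ⟨fun ⟨y, hy, h⟩ => φ.injective h ▸ hy, fun h => ⟨x, h, rfl⟩⟩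
  rcases A with A | A | A <;> rcases B with B | B | B <;> try exact Iff.rfl
  · exact hinj.mem_set_image
  · refine Set.exists_mem_image.trans (exists_congr fun d => and_congr_right fun _ => hmem _ _)
  · exact hmem _ _

end CellMap

theorem cellMap_mul {φ ψ : Equiv.Perm N} (hφ : ∀ k x, φ (T.s k x) = T.s k (φ x))
    (hψ : ∀ k x, ψ (T.s k x) = T.s k (ψ x))
    (h : ∀ k x, (φ * ψ) (T.s k x) = T.s k ((φ * ψ) x)) (A : T.Cell) :
    cellMap (φ * ψ) h A = cellMap φ hφ (cellMap ψ hψ A) := by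
  rcases cell_cases A with ⟨k, x, rfl⟩ | ⟨k, x, rfl⟩ | ⟨x, rfl⟩ <;>
    simp only [cellMap_vert, cellMap_edge, cellMap_face, Equiv.Perm.mul_apply]

theorem cellMap_one (h : ∀ k x, (1 : Equiv.Perm N) (T.s k x) = T.s k ((1 : Equiv.Perm N) x))
    (A : T.Cell) : cellMap 1 h A = A := by
  rcases cell_cases A with ⟨k, x, rfl⟩ | ⟨k, x, rfl⟩ | ⟨x, rfl⟩ <;>
    simp only [cellMap_vert, cellMap_edge, cellMap_face, Equiv.Perm.one_apply]

section Action

variable {G : Type v} [Group G] (ρ : G →* Equiv.Perm N)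
  (hρ : ∀ m k x, ρ m (T.s k x) = T.s k (ρ m x))

/-- The action on the cells induced by a colour preserving action on the nodes. -/
def cellHom : G →* Equiv.Perm T.Cell :=
  MonoidHom.toHomPerm
    { toFun := fun m => cellMap (ρ m) (hρ m)
      map_one' := by
        funext A
        simp only [map_one]
        exact cellMap_one _ A
      map_mul' := fun m m' => by
        funext A
        simp only [map_mul]
        exact cellMap_mul (hρ m) (hρ m') _ A }

theorem cellHom_mem_Aut [Nonempty N] (m : G) : cellHom ρ hρ m ∈ T.surface.Aut :=
  SimplicialSurface.mem_Aut_of_lt_iff fun _ _ => cellMap_lt (ρ m) (hρ m)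

end Action

/-- An automorphism of the surface permutes the nodes, and permutes the colours globally. -/
theorem exists_node_map [Nonempty N] (hT : T.Connected) {π : Equiv.Perm T.Cell}
    (hπ : π ∈ T.surface.Aut) :
    ∃ (φ : N → N) (τ : Colour → Colour), Function.Injective τ ∧
      (∀ k x, φ (T.s k x) = T.s (τ k) (φ x)) ∧ (∀ x, π (T.face x) = T.face (φ x)) ∧
      (∀ k x, π (T.edge k x) = T.edge (τ k) (φ x)) ∧
      ∀ k x, π (T.vert k x) = T.vert (τ k) (φ x) := by
  have hlt : ∀ A B, T.lt A B → T.lt (π A) (π B) := hπ.1.map_lt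
  have d1 : ∀ A, A ∈ T.verts → A ∈ T.edges → False :=
    fun _ h h' => Set.disjoint_left.1 T.surface.disjoint01 h h'
  have d2 : ∀ A, A ∈ T.verts → A ∈ T.faces → False :=
    fun _ h h' => Set.disjoint_left.1 T.surface.disjoint02 h h'
  have d3 : ∀ A, A ∈ T.edges → A ∈ T.faces → False :=
    fun _ h h' => Set.disjoint_left.1 T.surface.disjoint12 h h'
  have hface : ∀ x, ∃ y, π (T.face x) = T.face y :=
    fun x => exists_face (hπ.1.map_face (face_mem (T := T) x))
  -- An edge has a vertex below it and a face above it; only edges can be in the middle of such a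
  -- chain.
  have hedge : ∀ k x, π (T.edge k x) ∈ T.edges := by
    intro k x
    obtain ⟨a, b, -, hab⟩ := k.exists_other
    have h1 := lt_type (hlt (T.vert a x) (T.edge k x)
      (vert_lt_edge.2 ⟨((hab a).2 (Or.inl rfl)).symm, .refl x⟩))
    have h2 := lt_type (hlt (T.edge k x) (T.face x) (edge_lt_face.2 (Or.inl rfl)))
    have e1 := d1 (π (T.edge k x))
    have e2 := d2 (π (T.edge k x))
    have e3 := d3 (π (T.edge k x))
    tauto
  have hvert : ∀ k x, π (T.vert k x) ∈ T.verts := by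
    intro k x
    obtain ⟨a, b, -, hab⟩ := k.exists_other
    have h1 := lt_type (hlt (T.vert k x) (T.edge a x)
      (vert_lt_edge.2 ⟨((hab a).2 (Or.inl rfl)), .refl x⟩))
    have e1 := d3 _ (hedge a x)
    tauto
  choose φ hφ using hface
  have hτ : ∀ x k, ∃ l, π (T.edge k x) = T.edge l (φ x) := by
    intro x k
    obtain ⟨l, y, h⟩ := exists_edge (hedge k x)
    have h1 := hlt (T.edge k x) (T.face x) (edge_lt_face.2 (Or.inl rfl))
    rw [h, hφ] at h1
    exact ⟨l, h.trans (eq_edge_of_lt_face h1)⟩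
  choose τ hτ using hτ
  have hφinj : Function.Injective φ := by
    intro x y h
    rw [← face_inj (T := T), ← π.injective.eq_iff, hφ, hφ, h]
  have hτinj : ∀ x, Function.Injective (τ x) := by
    intro x k l h
    rw [← edge_left_inj (T := T) (x := x), ← π.injective.eq_iff, hτ, hτ, h]
  -- The image edge has only two faces, and injectivity of `φ` rules out `φ x` for the neighbour.
  have hs : ∀ k x, φ (T.s k x) = T.s (τ x k) (φ x) := by
    intro k x
    have h1 := hlt (T.edge k x) (T.face (T.s k x)) (edge_lt_face.2 (Or.inr rfl))
    rw [hτ, hφ] at h1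
    exact (edge_lt_face.1 h1).resolve_left fun h => T.ne_self k x (hφinj h)
  -- If the image missed the colour `τ x l` with `l ≠ k`, it would not lie on the image of the edge
  -- of colour `l`, although `vert k x` lies on that edge.
  have hv : ∀ k x, π (T.vert k x) = T.vert (τ x k) (φ x) := by
    intro k x
    obtain ⟨m, y, h⟩ := exists_vert (hvert k x)
    have h1 := hlt (T.vert k x) (T.face x) (vert_lt_face.2 (.refl x))
    rw [h, hφ] at h1
    rw [h, vert_inj]
    refine ⟨?_, vert_lt_face.1 h1⟩
    obtain ⟨l, rfl⟩ := Finite.surjective_of_injective (hτinj x) m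
    by_contra hne
    have hlk : l ≠ k := fun h => hne (by rw [h])
    have h2 := hlt (T.vert k x) (T.edge l x) (vert_lt_edge.2 ⟨hlk, .refl x⟩)
    rw [h, hτ] at h2
    exact (vert_lt_edge.1 h2).1 rfl
  -- Adjacent faces share the edge of colour `k` and the vertices missing the other two colours;
  -- each of these three cells fixes one value of `τ`.
  have hstep : ∀ k x, τ (T.s k x) = τ x := by
    intro k x
    funext l
    by_cases hlk : l = k
    · subst hlk
      have h1 := hτ (T.s l x) l
      rw [edge_s, hτ, hs, edge_inj] at h1
      exact T.colour_unique ⟨_, h1⟩ ⟨_, rfl⟩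
    · have h1 := hv l (T.s k x)
      rw [vert_s (Ne.symm hlk), hv, vert_inj] at h1
      exact h1.1.symm
  have hconst : ∀ x y, τ y = τ x := fun x y =>
    hT (fun y => τ y = τ x) (fun k y h => (hstep k y).trans h) x y rfl
  have x₀ : N := Classical.arbitrary N
  refine ⟨φ, τ x₀, hτinj x₀, fun k x => ?_, hφ, fun k x => ?_, fun k x => ?_⟩
  · rw [hs, hconst x₀ x]
  · rw [hτ, hconst x₀ x]
  · rw [hv, hconst x₀ x]

/-- If every symmetry of the coloured graph preserves the colours and agrees at some node with an
element of `G`, then `G` is the automorphism group of the surface. -/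
theorem exists_mulEquiv_Aut [Nonempty N] {G : Type v} [Group G] (hT : T.Connected)
    (ρ : G →* Equiv.Perm N) (hρ : ∀ m k x, ρ m (T.s k x) = T.s k (ρ m x))
    (hfree : ∀ m, (∀ x, ρ m x = x) → m = 1)
    (hrigid : ∀ (φ : N → N) (τ : Colour → Colour), Function.Injective τ →
      (∀ k x, φ (T.s k x) = T.s (τ k) (φ x)) → (∀ k, τ k = k) ∧ ∃ m x, φ x = ρ m x) :
    ∃ Φ : G ≃* T.surface.Aut, ∀ m x, (Φ m : Equiv.Perm T.Cell) (T.face x) = T.face (ρ m x) := by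
  let Ψ : G →* T.surface.Aut := (cellHom ρ hρ).codRestrict T.surface.Aut (cellHom_mem_Aut ρ hρ)
  have hΨ : ∀ m A, (Ψ m : Equiv.Perm T.Cell) A = cellMap (ρ m) (hρ m) A := fun m A => rfl
  refine ⟨MulEquiv.ofBijective Ψ ⟨?_, ?_⟩, fun m x => rfl⟩
  · rw [injective_iff_map_eq_one]
    intro m hm
    refine hfree m fun x => ?_
    rw [← face_inj (T := T), ← cellMap_face (ρ m) (hρ m), ← hΨ, hm]
    rfl
  · rintro ⟨π, hπ⟩
    obtain ⟨φ, τ, hτ, hs, hf, he, hv⟩ := exists_node_map hT hπ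
    obtain ⟨hτid, m, x₀, hx₀⟩ := hrigid φ τ hτ hs
    have hφ : ∀ x, φ x = ρ m x := fun x =>
      hT (fun x => φ x = ρ m x) (fun k x h => by rw [hs, hτid, h, hρ]) x₀ x hx₀
    refine ⟨m, Subtype.ext (Equiv.ext fun A => ?_)⟩
    rw [hΨ]
    change _ = π A
    rcases cell_cases A with ⟨k, x, rfl⟩ | ⟨k, x, rfl⟩ | ⟨x, rfl⟩
    · rw [cellMap_vert, hv, hφ, hτid]
    · rw [cellMap_edge, he, hφ, hτid]
    · rw [cellMap_face, hf, hφ]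

end TriInvolution

/-! ### Voltage coverings and left translations -/

namespace TriInvolution

/-- `R` may list an edge in one orientation only, as the tables of index pairs do; hence the
disjunction in `h'`. -/
theorem colourEdges_eq {N : Type u} (T : TriInvolution N) {R : N → N → Prop} {k : Colour}
    (h : ∀ x y, R x y → y = T.s k x) (h' : ∀ x, R x (T.s k x) ∨ R (T.s k x) x) :
    {e | ∃ x y, e = s(x, y) ∧ R x y} = T.colourEdges k := by
  ext e
  constructor
  · rintro ⟨x, y, rfl, hR⟩
    exact ⟨x, by rw [← h x y hR]⟩
  · rintro ⟨x, rfl⟩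
    rcases h' x with hR | hR
    · exact ⟨_, _, rfl, hR⟩
    · exact ⟨_, _, Sym2.eq_swap, hR⟩

/-- The covering of a coloured graph on `1, …, M`, possibly with double edges, given by voltages
in a group. -/
def ofVoltage {G : Type u} [Group G] {M : ℕ} (σ : Colour → ℕ → ℕ) (v : Colour → ℕ → G)
    (hmem : ∀ k i, 1 ≤ i ∧ i ≤ M → 1 ≤ σ k i ∧ σ k i ≤ M)
    (hinv : ∀ k i, 1 ≤ i ∧ i ≤ M → σ k (σ k i) = i)
    (hne : ∀ k i, 1 ≤ i ∧ i ≤ M → σ k i ≠ i)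
    (hv : ∀ k i, 1 ≤ i ∧ i ≤ M → v k i * v k (σ k i) = 1)
    (hinj : ∀ k l i, 1 ≤ i ∧ i ≤ M → σ k i = σ l i → v k i = v l i → k = l) :
    TriInvolution ({i : ℕ // 1 ≤ i ∧ i ≤ M} × G) where
  s k x := (⟨σ k x.1, hmem k x.1 x.1.2⟩, x.2 * v k x.1)
  invol k x := Prod.ext (Subtype.ext (hinv k x.1 x.1.2))
    (by simp only [mul_assoc, hv k x.1 x.1.2, mul_one])
  ne_self k x h := hne k x.1 x.1.2 (congrArg (fun y => (y.1 : ℕ)) h)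
  inj {k l x} h := hinj k l x.1 x.1.2 (congrArg (fun y => (y.1 : ℕ)) h)
    (mul_left_cancel (congrArg Prod.snd h))

/-- The permutations `(i, h) ↦ (i, m h)`. -/
def leftMul (I : Type*) (G : Type*) [Group G] : G →* Equiv.Perm (I × G) :=
  MonoidHom.toHomPerm
    { toFun := fun m x => (x.1, m * x.2)
      map_one' := by funext x; exact Prod.ext rfl (one_mul x.2)
      map_mul' := fun m m' => by funext x; exact Prod.ext rfl (mul_assoc m m' x.2) }

theorem leftMul_apply {I G : Type*} [Group G] (m : G) (x : I × G) :
    leftMul I G m x = (x.1, m * x.2) := rfl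

theorem eq_one_of_leftMul {I G : Type*} [Group G] [Nonempty I] {m : G}
    (h : ∀ x, leftMul I G m x = x) : m = 1 := by
  have := congrArg Prod.snd (h (Classical.arbitrary I, 1))
  simpa [leftMul_apply] using this

/-- The properties of the coloured graph of `T` and of its surface, when the edges of colour `k`
are described by another set `E k`. -/
theorem isCubic_and_exists_surface {G : Type u} [Group G] [Finite G] {M : ℕ} (hM : 1 ≤ M)
    (T : TriInvolution ({i : ℕ // 1 ≤ i ∧ i ≤ M} × G))
    (hρ : ∀ m k x, leftMul _ G m (T.s k x) = T.s k (leftMul _ G m x))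
    (E : Colour → Set (Sym2 ({i : ℕ // 1 ≤ i ∧ i ≤ M} × G))) (hE : E = T.colourEdges)
    (p : Prop) (hT : T.Connected)
    (hrigid : p → ∀ (φ : _ → _) (τ : Colour → Colour), Function.Injective τ →
      (∀ k x, φ (T.s k x) = T.s (τ k) (φ x)) →
      (∀ k, τ k = k) ∧ ∃ m x, φ x = leftMul _ G m x) :
    IsCubic (SimpleGraph.fromEdgeSet (⋃ k, E k)) ∧
      ∃ c : (SimpleGraph.fromEdgeSet (⋃ k, E k)).lineGraph.Coloring Colour,
        (∀ (e : (SimpleGraph.fromEdgeSet (⋃ k, E k)).edgeSet) (k : Colour),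
          c e = k ↔ (e : Sym2 ({i : ℕ // 1 ≤ i ∧ i ≤ M} × G)) ∈ E k) ∧
        (∀ (m : G) (k : Colour), Sym2.map (fun x => (x.1, m * x.2)) '' E k = E k) ∧
        IsCycleDoubleCover (SimpleGraph.fromEdgeSet (⋃ k, E k))
          (bicolouredCycles (SimpleGraph.fromEdgeSet (⋃ k, E k)) c) ∧
        (∀ (m : G), ∀ C ∈ bicolouredCycles (SimpleGraph.fromEdgeSet (⋃ k, E k)) c,
          Sym2.map (fun x => (x.1, m * x.2)) '' C ∈
            bicolouredCycles (SimpleGraph.fromEdgeSet (⋃ k, E k)) c) ∧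
        ∃ (α : Type u) (X : SimplicialSurface α)
          (I : X.CoverIso (SimpleGraph.fromEdgeSet (⋃ k, E k))
            (bicolouredCycles (SimpleGraph.fromEdgeSet (⋃ k, E k)) c)),
          p → ∃ Φ : G ≃* X.Aut, ∀ (m : G) x,
            (Φ m : Equiv.Perm α) (I.faceEquiv.symm x : α) =
              (I.faceEquiv.symm (x.1, m * x.2) : α) := by
  subst hE
  have : Finite {i : ℕ // 1 ≤ i ∧ i ≤ M} := (Set.finite_Icc 1 M).to_subtype
  have : Nonempty {i : ℕ // 1 ≤ i ∧ i ≤ M} := ⟨⟨1, le_rfl, hM⟩⟩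
  refine ⟨T.isCubic, T.coloring, T.coloring_eq_iff, ?_, T.isCycleDoubleCover, ?_, T.Cell,
    T.surface, T.coverIso, fun hp => ?_⟩
  · exact fun m => T.image_colourEdges (leftMul _ G m).surjective (hρ m)
  · intro m C hC
    obtain ⟨k, x, rfl⟩ := T.mem_bicolouredCycles_iff.1 hC
    exact T.mem_bicolouredCycles_iff.2 ⟨k, _, T.image_cyc (leftMul _ G m).apply_symm_apply
      (leftMul _ G m).symm_apply_apply (hρ m) k x⟩
  · exact exists_mulEquiv_Aut hT (leftMul _ G) hρ (fun m => eq_one_of_leftMul) (hrigid hp)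

/-- Connectedness of a covering. -/
theorem connected_of_generates {N : Type u} {T : TriInvolution N} {G : Type v} [Group G]
    {S : Set G} (hS : Subgroup.closure S = ⊤) (b : G → N)
    (hb : ∀ P : N → Prop, (∀ k x, P (T.s k x) ↔ P x) → ∀ x, ∃ h, P x ↔ P (b h))
    (hbS : ∀ P : N → Prop, (∀ k x, P (T.s k x) ↔ P x) → ∀ g ∈ S, ∀ h, P (b (h * g)) ↔ P (b h)) :
    T.Connected := by
  intro P hP x y hx
  have hP' : ∀ k x, P (T.s k x) ↔ P x := fun k x =>
    ⟨fun h => by simpa only [T.invol] using hP k _ h, hP k x⟩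
  -- The elements whose right multiplication preserves `P` on the section `b` form a subgroup, which
  -- contains `S`.
  have key : ∀ g ∈ Subgroup.closure S, ∀ h, P (b (h * g)) ↔ P (b h) := by
    intro g hg
    induction hg using Subgroup.closure_induction with
    | mem g hg => exact hbS P hP' g hg
    | one => simp
    | mul a c _ _ iha ihc => exact fun h => by rw [← mul_assoc, ihc, iha]
    | inv a _ ih => exact fun h => by rw [← ih (h * a⁻¹), inv_mul_cancel_right]
  obtain ⟨h, hh⟩ := hb P hP' x
  obtain ⟨h', hh'⟩ := hb P hP' y
  have := key (h⁻¹ * h') (hS ▸ Subgroup.mem_top _) h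
  rw [mul_inv_cancel_left] at this
  exact hh'.2 (this.2 (hh.1 hx))

end TriInvolution

theorem Colour.injective_cases {τ : Colour → Colour} (h : Function.Injective τ) :
    (τ .red = .red ∧ τ .green = .green ∧ τ .blue = .blue) ∨
    (τ .red = .red ∧ τ .green = .blue ∧ τ .blue = .green) ∨
    (τ .red = .green ∧ τ .green = .red ∧ τ .blue = .blue) ∨
    (τ .red = .green ∧ τ .green = .blue ∧ τ .blue = .red) ∨
    (τ .red = .blue ∧ τ .green = .red ∧ τ .blue = .green) ∨
    (τ .red = .blue ∧ τ .green = .green ∧ τ .blue = .red) := by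
  have key : ∀ a b c : Colour, a ≠ b ∧ a ≠ c ∧ b ≠ c →
    (a = .red ∧ b = .green ∧ c = .blue) ∨
    (a = .red ∧ b = .blue ∧ c = .green) ∨
    (a = .green ∧ b = .red ∧ c = .blue) ∨
    (a = .green ∧ b = .blue ∧ c = .red) ∨
    (a = .blue ∧ b = .red ∧ c = .green) ∨
    (a = .blue ∧ b = .green ∧ c = .red) := by
    intro a b c
    cases a <;> cases b <;> cases c <;> simp
  exact key _ _ _ ⟨h.ne (by decide), h.ne (by decide), h.ne (by decide)⟩

/-! ### Asymmetric surface -/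

/-- A 3-edge-coloured cubic graph without symmetries, even if these may permute the colours. -/
def asymmetricStep : Colour → Fin 10 → Fin 10
  | .red => ![5, 3, 7, 1, 6, 0, 4, 2, 9, 8]
  | .green => ![1, 0, 5, 7, 8, 2, 9, 3, 4, 6]
  | .blue => ![6, 8, 3, 2, 7, 9, 0, 4, 1, 5]

def asymmetricGraph : TriInvolution (ULift.{u} (Fin 10)) where
  s k x := ⟨asymmetricStep k x.down⟩
  invol k x := by
    have : ∀ k i, asymmetricStep k (asymmetricStep k i) = i := by decide
    exact congrArg ULift.up (this k x.down)
  ne_self k x h := by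
    have : ∀ k i, asymmetricStep k i ≠ i := by decide
    exact this k x.down (congrArg ULift.down h)
  inj {k l x} h := by
    have : ∀ i k l, asymmetricStep k i = asymmetricStep l i → k = l := by decide
    exact this x.down k l (congrArg ULift.down h)

theorem asymmetricGraph_connected : asymmetricGraph.{u}.Connected := by
  intro P hP x y hx
  have step : ∀ k i, P ⟨asymmetricStep k i⟩ ↔ P ⟨i⟩ := by
    refine fun k i => ⟨fun h => ?_, hP k ⟨i⟩⟩
    have := hP k _ h
    rwa [show asymmetricGraph.s k ⟨asymmetricStep k i⟩ = ⟨i⟩ from asymmetricGraph.invol k ⟨i⟩]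
      at this
  -- Every node is within distance three of node 0.
  have path : ∀ i : Fin 10, i = 0 ∨ (∃ a, i = asymmetricStep a 0) ∨
      (∃ a b, i = asymmetricStep b (asymmetricStep a 0)) ∨
      ∃ a b c, i = asymmetricStep c (asymmetricStep b (asymmetricStep a 0)) := by decide
  have key : ∀ i : Fin 10, P ⟨i⟩ ↔ P ⟨0⟩ := by
    intro i
    rcases path i with rfl | ⟨a, rfl⟩ | ⟨a, b, rfl⟩ | ⟨a, b, c, rfl⟩ <;> simp only [step]
  exact (key y.down).2 ((key x.down).1 hx)

theorem asymmetricGraph_rigid (φ : ULift.{u} (Fin 10) → ULift.{u} (Fin 10)) (τ : Colour → Colour)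
    (hτ : Function.Injective τ)
    (hφ : ∀ k x, φ (asymmetricGraph.s k x) = asymmetricGraph.s (τ k) (φ x)) :
    (∀ k, τ k = k) ∧ ∃ x, φ x = x := by
  -- Two closed walks at node 3 determine it and the colours: the triangle 3, 7, 2 here and the
  -- pentagon 3, 1, 8, 4, 7 in `h2`.
  have h1 : φ ⟨3⟩ = asymmetricGraph.s (τ .blue) (asymmetricGraph.s (τ .red)
      (asymmetricGraph.s (τ .green) (φ ⟨3⟩))) := by
    rw [← hφ, ← hφ, ← hφ]
    rfl
  have h2 : φ ⟨3⟩ = asymmetricGraph.s (τ .green) (asymmetricGraph.s (τ .blue)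
      (asymmetricGraph.s (τ .green) (asymmetricGraph.s (τ .blue)
      (asymmetricGraph.s (τ .red) (φ ⟨3⟩))))) := by
    rw [← hφ, ← hφ, ← hφ, ← hφ, ← hφ]
    rfl
  have key : ∀ (r g b : Colour) (i : Fin 10), (r ≠ g ∧ r ≠ b ∧ g ≠ b) ∧
      i = asymmetricStep b (asymmetricStep r (asymmetricStep g i)) ∧
      i = asymmetricStep g (asymmetricStep b (asymmetricStep g (asymmetricStep b
        (asymmetricStep r i)))) → (r = .red ∧ g = .green ∧ b = .blue) ∧ i = 3 := by decide
  obtain ⟨⟨hr, hg, hb⟩, hi⟩ := key (τ .red) (τ .green) (τ .blue) (φ ⟨3⟩).down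
    ⟨⟨hτ.ne (by decide), hτ.ne (by decide), hτ.ne (by decide)⟩,
      congrArg ULift.down h1, congrArg ULift.down h2⟩
  exact ⟨fun k => by cases k <;> assumption, ⟨3⟩, congrArg ULift.up hi⟩

theorem exists_surface_of_subsingleton (G : Type u) [Group G] [Subsingleton G] :
    ∃ (α : Type u) (X : SimplicialSurface α), Nonempty (X.Aut ≃* G) := by
  obtain ⟨Φ, -⟩ := TriInvolution.exists_mulEquiv_Aut (G := G) asymmetricGraph_connected.{u} 1
    (fun _ _ _ => rfl) (fun _ _ => Subsingleton.elim _ _) (fun φ τ hτ hφ => by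
      obtain ⟨h, x, hx⟩ := asymmetricGraph_rigid φ τ hτ hφ
      exact ⟨h, 1, x, hx⟩)
  exact ⟨_, _, ⟨Φ.symm⟩⟩

/-! ### Two generators -/

namespace TriInvolution

section TwoGenerators

/-- The index of the neighbour along the edge of a given colour, for two generators. -/
def idxTwo : Colour → ℕ → ℕ
  | .red, 1 => 2 | .red, 2 => 1 | .red, 3 => 4 | .red, 4 => 3 | .red, 5 => 6 | .red, 6 => 5
  | .green, 1 => 4 | .green, 4 => 1 | .green, 2 => 3 | .green, 3 => 2 | .green, 5 => 6
  | .green, 6 => 5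
  | .blue, 1 => 3 | .blue, 3 => 1 | .blue, 2 => 6 | .blue, 6 => 2 | .blue, 4 => 5 | .blue, 5 => 4
  | _, i => i

variable {G : Type u} [Group G]

/-- The group element by which an edge shifts the second coordinate, for two generators. -/
def voltTwo (g : Fin 2 → G) : Colour → ℕ → G
  | .red, 3 => g 0 | .red, 4 => (g 0)⁻¹ | .red, 5 => g 1 | .red, 6 => (g 1)⁻¹
  | _, _ => 1

/-- The graph for two generators. -/
def fruchtTwo (g : Fin 2 → G) (hg : ∀ j, g j ≠ 1) : TriInvolution (FruchtNode 2 G) :=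
  ofVoltage idxTwo (voltTwo g)
    (by
      rintro k i ⟨h1, h2⟩
      change i ≤ 6 at h2
      change 1 ≤ _ ∧ _ ≤ 6
      interval_cases i <;> cases k <;> decide)
    (by
      rintro k i ⟨h1, h2⟩
      change i ≤ 6 at h2
      interval_cases i <;> cases k <;> rfl)
    (by
      rintro k i ⟨h1, h2⟩
      change i ≤ 6 at h2
      interval_cases i <;> cases k <;> decide)
    (by
      rintro k i ⟨h1, h2⟩
      change i ≤ 6 at h2
      interval_cases i <;> cases k <;> simp [idxTwo, voltTwo])
    (by
      rintro k l i ⟨h1, h2⟩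
      change i ≤ 6 at h2
      -- Indices 5 and 6 are joined by both a red and a green base edge; their lifts differ because
      -- the second generator is not 1.
      have h := hg 1
      have h' := h.symm
      interval_cases i <;> cases k <;> cases l <;> simp [idxTwo, voltTwo, h, h'])

variable (g : Fin 2 → G) (hg : ∀ j, g j ≠ 1)

theorem fruchtTwo_idx (k : Colour) (x : FruchtNode 2 G) :
    (((fruchtTwo g hg).s k x).1 : ℕ) = idxTwo k x.1 := rfl

theorem fruchtTwo_snd (k : Colour) (x : FruchtNode 2 G) :
    ((fruchtTwo g hg).s k x).2 = x.2 * voltTwo g k x.1 := rfl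

theorem fruchtTwo_eq {k : Colour} {x y : FruchtNode 2 G} (h : (y.1 : ℕ) = idxTwo k x.1)
    (h' : y.2 = x.2 * voltTwo g k x.1) : y = (fruchtTwo g hg).s k x :=
  Prod.ext (Subtype.ext h) h'

theorem fruchtTwo_edges : fruchtEdges g = (fruchtTwo g hg).colourEdges := by
  funext k
  refine colourEdges_eq _ ?_ ?_
  · rintro ⟨⟨i, hi⟩, h⟩ ⟨⟨j, hj⟩, h'⟩ hR
    apply fruchtTwo_eq <;> rcases hR with ⟨h1, h2⟩ | ⟨rfl, m, h1, h2, h3⟩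
    · cases k <;> simp only [fruchtQ, simpQ, if_pos, Set.mem_singleton_iff, Set.mem_insert_iff,
        Prod.mk.injEq] at h1
      · simp [h1, idxTwo]
      all_goals rcases h1 with h1 | h1 | h1 <;> simp [h1, idxTwo]
    · fin_cases m <;> simp [fruchtShift] at h1 h2 <;> simp [h1, h2, idxTwo]
    · cases k <;> simp only [fruchtQ, simpQ, if_pos, Set.mem_singleton_iff, Set.mem_insert_iff,
        Prod.mk.injEq] at h1 h2
      · obtain ⟨rfl, rfl⟩ := h1
        simp [h2, voltTwo]
      all_goals simp [h2, voltTwo]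
    · fin_cases m <;> simp [fruchtShift] at h1 h3 <;> simp [h1, h3, voltTwo]
  · rintro ⟨⟨i, h1, h2⟩, h⟩
    simp only [fruchtTwo_idx, fruchtTwo_snd]
    change i ≤ 6 at h2
    interval_cases i <;> cases k <;>
      simp [fruchtQ, simpQ, fruchtShift, Fin.exists_fin_two, idxTwo, voltTwo]

theorem fruchtTwo_leftMul (m : G) (k : Colour) (x : FruchtNode 2 G) :
    leftMul _ G m ((fruchtTwo g hg).s k x) = (fruchtTwo g hg).s k (leftMul _ G m x) :=
  Prod.ext rfl (mul_assoc _ _ _).symm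

theorem fruchtTwo_connected (hS : Subgroup.closure (Set.range g) = ⊤) :
    (fruchtTwo g hg).Connected := by
  refine connected_of_generates hS (fun h => (⟨1, by decide⟩, h)) ?_ ?_
  all_goals
    intro P hP
    have key : ∀ (k : Colour) (i j : ℕ) (hi : 1 ≤ i ∧ i ≤ fruchtNum 2)
        (hj : 1 ≤ j ∧ j ≤ fruchtNum 2) (h : G), j = idxTwo k i →
        (P (⟨j, hj⟩, h * voltTwo g k i) ↔ P (⟨i, hi⟩, h)) := by
      rintro k i j hi hj h rfl
      exact hP k (⟨i, hi⟩, h)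
    have e2 := fun h => key .red 1 2 (by decide) (by decide) h rfl
    have e3 := fun h => key .blue 1 3 (by decide) (by decide) h rfl
    have e4 := fun h => key .green 1 4 (by decide) (by decide) h rfl
    have e5 := fun h => key .blue 4 5 (by decide) (by decide) h rfl
    have e6 := fun h => key .blue 2 6 (by decide) (by decide) h rfl
    simp only [voltTwo, mul_one] at e2 e3 e4 e5 e6
  · rintro ⟨⟨i, h1, h2⟩, h⟩
    refine ⟨h, ?_⟩
    change i ≤ 6 at h2
    interval_cases i
    · rfl
    · exact e2 h
    · exact e3 h
    · exact e4 h
    · exact (e5 h).trans (e4 h)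
    · exact (e6 h).trans (e2 h)
  · rintro _ ⟨j, rfl⟩ h
    fin_cases j
    -- Moving inside layers costs nothing; the red edge from index 3 to 4 realises `g 0`, and the
    -- one from 5 to 6 below realises `g 1`.
    · exact (e4 _).symm.trans ((key .red 3 4 (by decide) (by decide) h rfl).trans (e3 h))
    · exact (e2 _).symm.trans ((e6 _).symm.trans
        ((key .red 5 6 (by decide) (by decide) h rfl).trans ((e5 h).trans (e4 h))))

/-- The index part of the rigidity test, with voltages ignored. Eight pairs of a colour permutation
and a starting index survive, so for two generators the base graph alone is not rigid. -/
theorem idxTwo_closed (r b c : Colour) (i : ℕ) (hi : 1 ≤ i ∧ i ≤ 6)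
    (h : (r = .red ∧ b = .green ∧ c = .blue) ∨ (r = .red ∧ b = .blue ∧ c = .green) ∨
      (r = .green ∧ b = .red ∧ c = .blue) ∨ (r = .green ∧ b = .blue ∧ c = .red) ∨
      (r = .blue ∧ b = .red ∧ c = .green) ∨ (r = .blue ∧ b = .green ∧ c = .red))
    (h1 : idxTwo c (idxTwo b (idxTwo r i)) = i)
    (h2 : idxTwo c (idxTwo b (idxTwo c (idxTwo b (idxTwo c (idxTwo b i))))) = i) :
    ((r = .red ∧ b = .green ∧ c = .blue) ∧ (i = 1 ∨ i = 3)) ∨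
    ((r = .red ∧ b = .blue ∧ c = .green) ∧ (i = 2 ∨ i = 4)) ∨
    ((r = .green ∧ b = .red ∧ c = .blue) ∧ (i = 1 ∨ i = 3)) ∨
    ((r = .green ∧ b = .blue ∧ c = .red) ∧ (i = 2 ∨ i = 4)) := by
  obtain ⟨hi1, hi2⟩ := hi
  rcases h with ⟨rfl, rfl, rfl⟩ | ⟨rfl, rfl, rfl⟩ | ⟨rfl, rfl, rfl⟩ | ⟨rfl, rfl, rfl⟩ |
    ⟨rfl, rfl, rfl⟩ | ⟨rfl, rfl, rfl⟩ <;>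
  interval_cases i <;> revert h1 h2 <;> decide

theorem fruchtTwo_rigid (h12 : g 0 * g 1 ≠ 1)
    (φ : FruchtNode 2 G → FruchtNode 2 G) (τ : Colour → Colour) (hτ : Function.Injective τ)
    (hφ : ∀ k x, φ ((fruchtTwo g hg).s k x) = (fruchtTwo g hg).s (τ k) (φ x)) :
    (∀ k, τ k = k) ∧ ∃ m x, φ x = leftMul _ G m x := by
  have hg0 := hg 0
  have hg1 := hg 1
  have h12' : (g 1)⁻¹ * (g 0)⁻¹ ≠ 1 := by rwa [← mul_inv_rev, Ne, inv_eq_one]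
  -- The test words are the triangle 1, 2, 3 and the green-blue hexagon through index 1. Of the
  -- eight candidates, the voltages exclude six, since `g 0`, `g 0 * g 1` and their inverses are not
  -- 1. The swap of green and blue with index 2 passes both words, whence the second alternative and
  -- the need for all `h`.
  have key : ∀ h : G, ((τ .red = .red ∧ τ .green = .green ∧ τ .blue = .blue) ∧
        ((φ (⟨1, by decide⟩, h)).1 : ℕ) = 1) ∨
      ((τ .red = .red ∧ τ .green = .blue ∧ τ .blue = .green) ∧
        ((φ (⟨1, by decide⟩, h)).1 : ℕ) = 2) := by
    intro h
    have F1 : (fruchtTwo g hg).s (τ .blue) ((fruchtTwo g hg).s (τ .green)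
        ((fruchtTwo g hg).s (τ .red) (φ (⟨1, by decide⟩, h)))) = φ (⟨1, by decide⟩, h) := by
      rw [← hφ, ← hφ, ← hφ]
      refine congrArg φ (Prod.ext (Subtype.ext (by simp [fruchtTwo_idx, idxTwo]))
        (by simp [fruchtTwo_snd, voltTwo]))
    have F2 : (fruchtTwo g hg).s (τ .blue) ((fruchtTwo g hg).s (τ .green)
        ((fruchtTwo g hg).s (τ .blue) ((fruchtTwo g hg).s (τ .green)
        ((fruchtTwo g hg).s (τ .blue) ((fruchtTwo g hg).s (τ .green)
          (φ (⟨1, by decide⟩, h))))))) = φ (⟨1, by decide⟩, h) := by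
      rw [← hφ, ← hφ, ← hφ, ← hφ, ← hφ, ← hφ]
      refine congrArg φ (Prod.ext (Subtype.ext (by simp [fruchtTwo_idx, idxTwo]))
        (by simp [fruchtTwo_snd, voltTwo]))
    generalize φ (⟨1, by decide⟩, h) = y at F1 F2 ⊢
    have F1i := congrArg (fun y => (y.1 : ℕ)) F1
    have F2i := congrArg (fun y => (y.1 : ℕ)) F2
    have F1v := congrArg Prod.snd F1
    have F2v := congrArg Prod.snd F2
    obtain ⟨⟨i, h1, h2⟩, h'⟩ := y
    simp only [fruchtTwo_idx, fruchtTwo_snd, mul_assoc, mul_eq_left] at F1i F2i F1v F2v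
    clear F1 F2 hφ
    rcases idxTwo_closed _ _ _ i ⟨h1, h2⟩ (Colour.injective_cases hτ) F1i F2i with
      ⟨⟨hr, hb, hc⟩, rfl | rfl⟩ | ⟨⟨hr, hb, hc⟩, rfl | rfl⟩ | ⟨⟨hr, hb, hc⟩, rfl | rfl⟩ |
      ⟨⟨hr, hb, hc⟩, rfl | rfl⟩ <;>
    simp [hr, hb, hc, idxTwo, voltTwo, hg0, h12, h12'] at F1v F2v ⊢
  rcases key 1 with ⟨⟨hr, hb, hc⟩, hi⟩ | ⟨⟨hr, hb, hc⟩, hi⟩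
  · refine ⟨fun k => by cases k <;> assumption, (φ (⟨1, by decide⟩, 1)).2, (⟨1, by decide⟩, 1), ?_⟩
    exact Prod.ext (Subtype.ext hi) (mul_one _).symm
  -- The word green, red, blue leads from index 1 to index 1 in another layer. Its recolouring blue,
  -- red, green leads from index 2 to index 6, whereas `key` in that layer demands index 2.
  · have hw : (fruchtTwo g hg).s .blue ((fruchtTwo g hg).s .red ((fruchtTwo g hg).s .green
        (⟨1, by decide⟩, 1))) = (⟨1, by decide⟩, (g 0)⁻¹) :=
      Prod.ext rfl (by simp [fruchtTwo_idx, fruchtTwo_snd, idxTwo, voltTwo])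
    have hi' : ((φ (⟨1, by decide⟩, (g 0)⁻¹)).1 : ℕ) = 2 := by
      rcases key (g 0)⁻¹ with ⟨⟨-, hb', -⟩, -⟩ | ⟨-, hi'⟩
      · rw [hb] at hb'
        cases hb'
      · exact hi'
    rw [← hw, hφ, hφ, hφ, hr, hb, hc, fruchtTwo_idx, fruchtTwo_idx, fruchtTwo_idx, hi] at hi'
    exact absurd hi' (by decide)

end TwoGenerators

end TriInvolution

/-! ### More than two generators: the base graph -/

namespace TriInvolution

section ManyGenerators

/-- The index of the neighbour along the edge of a given colour, for `n > 2` generators. -/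
def idxMany (n : ℕ) : Colour → ℕ → ℕ
  | .red, i => if i = 1 then 6 else if i = 6 then 1 else if i = 2 then 3 else if i = 3 then 2
      else if i = 4 then 5 else if i = 5 then 4 else if i % 2 = 1 then i + 1 else i - 1
  | .green, i => if i = 1 then 2 else if i = 2 then 1 else if i = 3 then 7 else if i = 7 then 3
      else if i = 4 then 6 else if i = 6 then 4 else if i = 5 then 8 else if i = 8 then 5
      else if i % 2 = 1 then i + 1 else i - 1
  | .blue, i => if i = 1 then 3 else if i = 3 then 1 else if i = 2 then 4 else if i = 4 then 2
      else if i = 5 then 7 else if i = 7 then 5 else if i = 6 then 2 * n + 6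
      else if i = 2 * n + 6 then 6 else if i % 2 = 0 then i + 1 else i - 1

section Index

variable {n i : ℕ} (hn : 2 < n) (hi : 1 ≤ i ∧ i ≤ 2 * n + 6)
include hn hi

/-- The case tables for the three colours are put in a form usable by `omega`, which makes questions
about closed colour words linear arithmetic in `i` and `n`. -/
theorem idxMany_red : (i = 1 ∧ idxMany n .red i = 6) ∨ (i = 6 ∧ idxMany n .red i = 1) ∨
    (i = 2 ∧ idxMany n .red i = 3) ∨ (i = 3 ∧ idxMany n .red i = 2) ∨
    (i = 4 ∧ idxMany n .red i = 5) ∨ (i = 5 ∧ idxMany n .red i = 4) ∨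
    (7 ≤ i ∧ i % 2 = 1 ∧ idxMany n .red i = i + 1) ∨
    (8 ≤ i ∧ i % 2 = 0 ∧ idxMany n .red i + 1 = i) := by
  rcases lt_or_ge i 9 with h | h
  · obtain ⟨h1, h2⟩ := hi
    interval_cases i <;> simp [idxMany]
  · have h1 : i ≠ 1 := by omega
    have h2 : i ≠ 2 := by omega
    have h3 : i ≠ 3 := by omega
    have h4 : i ≠ 4 := by omega
    have h5 : i ≠ 5 := by omega
    have h6 : i ≠ 6 := by omega
    simp only [idxMany, h1, h2, h3, h4, h5, h6, if_false, false_and, false_or]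
    split_ifs <;> omega

theorem idxMany_green : (i = 1 ∧ idxMany n .green i = 2) ∨ (i = 2 ∧ idxMany n .green i = 1) ∨
    (i = 3 ∧ idxMany n .green i = 7) ∨ (i = 7 ∧ idxMany n .green i = 3) ∨
    (i = 4 ∧ idxMany n .green i = 6) ∨ (i = 6 ∧ idxMany n .green i = 4) ∨
    (i = 5 ∧ idxMany n .green i = 8) ∨ (i = 8 ∧ idxMany n .green i = 5) ∨
    (9 ≤ i ∧ i % 2 = 1 ∧ idxMany n .green i = i + 1) ∨
    (10 ≤ i ∧ i % 2 = 0 ∧ idxMany n .green i + 1 = i) := by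
  rcases lt_or_ge i 9 with h | h
  · obtain ⟨h1, h2⟩ := hi
    interval_cases i <;> simp [idxMany]
  · have h1 : i ≠ 1 := by omega
    have h2 : i ≠ 2 := by omega
    have h3 : i ≠ 3 := by omega
    have h4 : i ≠ 4 := by omega
    have h5 : i ≠ 5 := by omega
    have h6 : i ≠ 6 := by omega
    have h7 : i ≠ 7 := by omega
    have h8 : i ≠ 8 := by omega
    simp only [idxMany, h1, h2, h3, h4, h5, h6, h7, h8, if_false, false_and, false_or]
    split_ifs <;> omega

theorem idxMany_blue : (i = 1 ∧ idxMany n .blue i = 3) ∨ (i = 3 ∧ idxMany n .blue i = 1) ∨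
    (i = 2 ∧ idxMany n .blue i = 4) ∨ (i = 4 ∧ idxMany n .blue i = 2) ∨
    (i = 5 ∧ idxMany n .blue i = 7) ∨ (i = 7 ∧ idxMany n .blue i = 5) ∨
    (i = 6 ∧ idxMany n .blue i = 2 * n + 6) ∨ (i = 2 * n + 6 ∧ idxMany n .blue i = 6) ∨
    (8 ≤ i ∧ i < 2 * n + 6 ∧ i % 2 = 0 ∧ idxMany n .blue i = i + 1) ∨
    (9 ≤ i ∧ i % 2 = 1 ∧ idxMany n .blue i + 1 = i) := by
  rcases lt_or_ge i 9 with h | h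
  · interval_cases i <;> simp [idxMany] <;> omega
  · have h1 : i ≠ 1 := by omega
    have h2 : i ≠ 2 := by omega
    have h3 : i ≠ 3 := by omega
    have h4 : i ≠ 4 := by omega
    have h5 : i ≠ 5 := by omega
    have h6 : i ≠ 6 := by omega
    have h7 : i ≠ 7 := by omega
    simp only [idxMany, h1, h2, h3, h4, h5, h6, h7, if_false, false_and, false_or]
    split_ifs <;> omega

theorem idxMany_mem (k : Colour) : 1 ≤ idxMany n k i ∧ idxMany n k i ≤ 2 * n + 6 := by
  cases k
  · have := idxMany_red hn hi; omega
  · have := idxMany_green hn hi; omega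
  · have := idxMany_blue hn hi; omega

theorem idxMany_invol (k : Colour) : idxMany n k (idxMany n k i) = i := by
  have hi' := idxMany_mem hn hi k
  cases k
  · have h := idxMany_red hn hi
    have h' := idxMany_red hn hi'
    generalize idxMany n .red (idxMany n .red i) = j at *
    omega
  · have h := idxMany_green hn hi
    have h' := idxMany_green hn hi'
    omega
  · have h := idxMany_blue hn hi
    have h' := idxMany_blue hn hi'
    omega

theorem idxMany_ne (k : Colour) : idxMany n k i ≠ i := by
  cases k
  · have := idxMany_red hn hi; omega
  · have := idxMany_green hn hi; omega
  · have := idxMany_blue hn hi; omega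

/-- The only double edges of the base graph are the red-green ones between consecutive indices from
9 on; the voltages must separate these. -/
theorem idxMany_inj {k l : Colour} (h : idxMany n k i = idxMany n l i) :
    k = l ∨ (9 ≤ i ∧ ((k = .red ∧ l = .green) ∨ (k = .green ∧ l = .red))) := by
  have h1 := idxMany_red hn hi
  have h2 := idxMany_green hn hi
  have h3 := idxMany_blue hn hi
  cases k <;> cases l <;> simp <;> omega

/-- A closed word in three distinct colours runs around a triangle. The triangles of the base graph
are 1, 2, 3 and 5, 7, 8, and in each the start is the corner between the first and the last colour.
The next five lemmas treat the other orders. -/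
theorem idxMany_green_red_blue (h : idxMany n .blue (idxMany n .red (idxMany n .green i)) = i) :
    i = 1 ∨ i = 5 := by
  have h1 := idxMany_green hn hi
  have m1 := idxMany_mem hn hi .green
  have h2 := idxMany_red hn m1
  have m2 := idxMany_mem hn m1 .red
  have h3 := idxMany_blue hn m2
  omega

theorem idxMany_blue_red_green (h : idxMany n .green (idxMany n .red (idxMany n .blue i)) = i) :
    i = 1 ∨ i = 5 := by
  have h1 := idxMany_blue hn hi
  have m1 := idxMany_mem hn hi .blue
  have h2 := idxMany_red hn m1
  have m2 := idxMany_mem hn m1 .red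
  have h3 := idxMany_green hn m2
  omega

theorem idxMany_red_blue_green (h : idxMany n .green (idxMany n .blue (idxMany n .red i)) = i) :
    i = 2 ∨ i = 8 := by
  have h1 := idxMany_red hn hi
  have m1 := idxMany_mem hn hi .red
  have h2 := idxMany_blue hn m1
  have m2 := idxMany_mem hn m1 .blue
  have h3 := idxMany_green hn m2
  omega

theorem idxMany_green_blue_red (h : idxMany n .red (idxMany n .blue (idxMany n .green i)) = i) :
    i = 2 ∨ i = 8 := by
  have h1 := idxMany_green hn hi
  have m1 := idxMany_mem hn hi .green
  have h2 := idxMany_blue hn m1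
  have m2 := idxMany_mem hn m1 .blue
  have h3 := idxMany_red hn m2
  omega

theorem idxMany_red_green_blue (h : idxMany n .blue (idxMany n .green (idxMany n .red i)) = i) :
    i = 3 ∨ i = 7 := by
  have h1 := idxMany_red hn hi
  have m1 := idxMany_mem hn hi .red
  have h2 := idxMany_green hn m1
  have m2 := idxMany_mem hn m1 .green
  have h3 := idxMany_blue hn m2
  omega

theorem idxMany_blue_green_red (h : idxMany n .red (idxMany n .green (idxMany n .blue i)) = i) :
    i = 3 ∨ i = 7 := by
  have h1 := idxMany_blue hn hi
  have m1 := idxMany_mem hn hi .blue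
  have h2 := idxMany_green hn m1
  have m2 := idxMany_mem hn m1 .green
  have h3 := idxMany_red hn m2
  omega

end Index
end ManyGenerators
end TriInvolution

/-! ### More than two generators: the covering -/

namespace TriInvolution

section ManyGenerators

/-- The triangle word `h1` leaves two starting indices for each colour permutation. The 4-word `h2`
removes all wrong ones except index 2 with red and blue exchanged, a reflection of the 4-cycle 1, 6,
4, 2; the 6-word `h3` removes that one. -/
theorem idxMany_closed {n i : ℕ} (hn : 2 < n) (hi : 1 ≤ i ∧ i ≤ 2 * n + 6) {r g b : Colour}
    (h : (r = .red ∧ g = .green ∧ b = .blue) ∨ (r = .red ∧ g = .blue ∧ b = .green) ∨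
      (r = .green ∧ g = .red ∧ b = .blue) ∨ (r = .green ∧ g = .blue ∧ b = .red) ∨
      (r = .blue ∧ g = .red ∧ b = .green) ∨ (r = .blue ∧ g = .green ∧ b = .red))
    (h1 : idxMany n b (idxMany n r (idxMany n g i)) = i)
    (h2 : idxMany n g (idxMany n b (idxMany n g (idxMany n r i))) = i)
    (h3 : idxMany n b (idxMany n g (idxMany n b (idxMany n r (idxMany n b (idxMany n g i))))) = i) :
    (r = .red ∧ g = .green ∧ b = .blue) ∧ i = 1 := by
  have m1 := idxMany_mem hn hi r
  have m2 := idxMany_mem hn m1 g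
  have m3 := idxMany_mem hn m2 b
  rcases h with ⟨rfl, rfl, rfl⟩ | ⟨rfl, rfl, rfl⟩ | ⟨rfl, rfl, rfl⟩ | ⟨rfl, rfl, rfl⟩ |
    ⟨rfl, rfl, rfl⟩ | ⟨rfl, rfl, rfl⟩
  · refine ⟨⟨rfl, rfl, rfl⟩, ?_⟩
    have h := idxMany_green_red_blue hn hi h1
    have e1 := idxMany_red hn hi
    have e2 := idxMany_green hn m1
    have e3 := idxMany_blue hn m2
    have e4 := idxMany_green hn m3
    omega
  · exfalso
    have h := idxMany_blue_red_green hn hi h1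
    have e1 := idxMany_red hn hi
    have e2 := idxMany_blue hn m1
    have e3 := idxMany_green hn m2
    have e4 := idxMany_blue hn m3
    omega
  · exfalso
    have h := idxMany_red_green_blue hn hi h1
    have e1 := idxMany_green hn hi
    have e2 := idxMany_red hn m1
    have e3 := idxMany_blue hn m2
    have e4 := idxMany_red hn m3
    omega
  · exfalso
    have h := idxMany_blue_green_red hn hi h1
    have e1 := idxMany_green hn hi
    have e2 := idxMany_blue hn m1
    have e3 := idxMany_red hn m2
    have e4 := idxMany_blue hn m3
    omega
  · exfalso
    have h := idxMany_red_blue_green hn hi h1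
    have e1 := idxMany_blue hn hi
    have e2 := idxMany_red hn m1
    have e3 := idxMany_green hn m2
    have e4 := idxMany_red hn m3
    omega
  · exfalso
    have h := idxMany_green_blue_red hn hi h1
    have m1' := idxMany_mem hn hi .green
    have m2' := idxMany_mem hn m1' .red
    have m3' := idxMany_mem hn m2' .blue
    have m4' := idxMany_mem hn m3' .red
    have m5' := idxMany_mem hn m4' .green
    have f1 := idxMany_green hn hi
    have f2 := idxMany_red hn m1'
    have f3 := idxMany_blue hn m2'
    have f4 := idxMany_red hn m3'
    have f5 := idxMany_green hn m4'
    have f6 := idxMany_red hn m5'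
    rcases h with rfl | rfl
    · clear h1 h2 m1 m2 m3
      omega
    · have e1 := idxMany_blue hn hi
      have e2 := idxMany_green hn m1
      have e3 := idxMany_red hn m2
      have e4 := idxMany_green hn m3
      clear f1 f2 f3 f4 f5 f6
      omega

variable {G : Type u} [Group G] {n : ℕ}

theorem fruchtNum_eq (hn : 2 < n) : fruchtNum n = 2 * n + 6 := if_neg (by omega)

/-- The group element by which an edge shifts the second coordinate, for `n > 2` generators. -/
def voltMany (g : Fin n → G) : Colour → ℕ → G
  -- With generators counted from 0, the red edge of `g j` joins the indices `2 * j + 7` and `2 * j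
  -- + 8`, and for both of them `(i - 7) / 2 = j`.
  | .red, i => if h : 7 ≤ i ∧ (i - 7) / 2 < n then
      (if i % 2 = 1 then g ⟨(i - 7) / 2, h.2⟩ else (g ⟨(i - 7) / 2, h.2⟩)⁻¹) else 1
  | _, _ => 1

theorem voltMany_odd (g : Fin n → G) (j : Fin n) : voltMany g .red (2 * j + 7) = g j := by
  have h := j.2
  have h2 : (2 * (j : ℕ) + 7) % 2 = 1 := by omega
  simp [voltMany, h2]

theorem voltMany_even (g : Fin n → G) (j : Fin n) : voltMany g .red (2 * j + 8) = (g j)⁻¹ := by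
  have h := j.2
  have h1 : (2 * (j : ℕ) + 1) / 2 = j := by omega
  have h2 : (2 * (j : ℕ) + 8) % 2 = 0 := by omega
  have h3 : 7 ≤ 2 * (j : ℕ) + 8 := by omega
  simp [voltMany, h1, h2, h3]

theorem voltMany_small (g : Fin n → G) {i : ℕ} (hi : i < 7) : voltMany g .red i = 1 := by
  rw [voltMany, dif_neg (by omega)]

theorem exists_fin_of_ge {i : ℕ} (hi : i ≤ 2 * n + 6) (h7 : 7 ≤ i) :
    ∃ j : Fin n, i = 2 * j + 7 ∨ i = 2 * j + 8 :=
  ⟨⟨(i - 7) / 2, by omega⟩, by simp only []; omega⟩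

theorem idxMany_red_odd (j : ℕ) : idxMany n .red (2 * j + 7) = 2 * j + 8 := by
  simp only [idxMany]
  split_ifs <;> omega

theorem idxMany_red_even (j : ℕ) : idxMany n .red (2 * j + 8) = 2 * j + 7 := by
  simp only [idxMany]
  split_ifs <;> omega

theorem voltMany_ne_one {g : Fin n → G} (hg : ∀ j, g j ≠ 1) {i : ℕ} (hi : i ≤ 2 * n + 6)
    (h7 : 7 ≤ i) : voltMany g .red i ≠ 1 := by
  obtain ⟨j, rfl | rfl⟩ := exists_fin_of_ge hi h7
  · rw [voltMany_odd]
    exact hg j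
  · rw [voltMany_even]
    exact inv_ne_one.2 (hg j)

theorem voltMany_mul {g : Fin n → G} (hn : 2 < n) {i : ℕ} (hi : 1 ≤ i ∧ i ≤ 2 * n + 6)
    (k : Colour) : voltMany g k i * voltMany g k (idxMany n k i) = 1 := by
  cases k
  · rcases lt_or_ge i 7 with h | h
    · have := idxMany_red hn hi
      rw [voltMany_small g h, voltMany_small g (by omega), one_mul]
    · obtain ⟨j, rfl | rfl⟩ := exists_fin_of_ge hi.2 h
      · rw [voltMany_odd, idxMany_red_odd, voltMany_even, mul_inv_cancel]
      · rw [voltMany_even, idxMany_red_even, voltMany_odd, inv_mul_cancel]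
  · exact one_mul 1
  · exact one_mul 1

/-- The graph for more than two generators, which may be repeated. -/
def fruchtMany (hn : 2 < n) (g : Fin n → G) (hg : ∀ j, g j ≠ 1) :
    TriInvolution (FruchtNode n G) :=
  ofVoltage (idxMany n) (voltMany g)
    (by
      rw [fruchtNum_eq hn]
      exact fun k i hi => idxMany_mem hn hi k)
    (by
      rw [fruchtNum_eq hn]
      exact fun k i hi => idxMany_invol hn hi k)
    (by
      rw [fruchtNum_eq hn]
      exact fun k i hi => idxMany_ne hn hi k)
    (by
      rw [fruchtNum_eq hn]
      exact fun k i hi => voltMany_mul hn hi k)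
    (by
      rw [fruchtNum_eq hn]
      intro k l i hi h hv
      rcases idxMany_inj hn hi h with h | ⟨h9, ⟨rfl, rfl⟩ | ⟨rfl, rfl⟩⟩
      · exact h
      · exact absurd hv (voltMany_ne_one hg hi.2 (by omega))
      · exact absurd hv.symm (voltMany_ne_one hg hi.2 (by omega)))

variable (hn : 2 < n) (g : Fin n → G) (hg : ∀ j, g j ≠ 1)

theorem fruchtMany_idx (k : Colour) (x : FruchtNode n G) :
    (((fruchtMany hn g hg).s k x).1 : ℕ) = idxMany n k x.1 := rfl

theorem fruchtMany_snd (k : Colour) (x : FruchtNode n G) :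
    ((fruchtMany hn g hg).s k x).2 = x.2 * voltMany g k x.1 := rfl

theorem fruchtMany_eq {k : Colour} {x y : FruchtNode n G} (h : (y.1 : ℕ) = idxMany n k x.1)
    (h' : y.2 = x.2 * voltMany g k x.1) : y = (fruchtMany hn g hg).s k x :=
  Prod.ext (Subtype.ext h) h'

theorem mem_modQ_red {i j : ℕ} : (i, j) ∈ modQ n .red ↔
    (i = 1 ∧ j = 6) ∨ (i = 2 ∧ j = 3) ∨ (i = 4 ∧ j = 5) := by
  simp [modQ]

theorem mem_modQ_green {i j : ℕ} : (i, j) ∈ modQ n .green ↔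
    (i = 1 ∧ j = 2) ∨ (i = 3 ∧ j = 7) ∨ (i = 4 ∧ j = 6) ∨ (i = 5 ∧ j = 8) ∨
      (9 ≤ i ∧ i ≤ 2 * n + 5 ∧ i % 2 = 1 ∧ j = i + 1) := by
  have : (∃ m, 2 ≤ m ∧ m ≤ n ∧ i = 2 * m + 5 ∧ j = 2 * m + 6) ↔
      (9 ≤ i ∧ i ≤ 2 * n + 5 ∧ i % 2 = 1 ∧ j = i + 1) := by
    constructor
    · rintro ⟨m, h⟩
      omega
    · exact fun h => ⟨(i - 5) / 2, by omega⟩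
  simp [modQ, this, or_assoc]

theorem mem_modQ_blue {i j : ℕ} : (i, j) ∈ modQ n .blue ↔
    (i = 1 ∧ j = 3) ∨ (i = 2 ∧ j = 4) ∨ (i = 5 ∧ j = 7) ∨ (i = 6 ∧ j = 2 * n + 6) ∨
      (8 ≤ i ∧ i ≤ 2 * n + 4 ∧ i % 2 = 0 ∧ j = i + 1) := by
  have : (∃ m, 2 ≤ m ∧ m ≤ n ∧ i = 2 * m + 4 ∧ j = 2 * m + 5) ↔
      (8 ≤ i ∧ i ≤ 2 * n + 4 ∧ i % 2 = 0 ∧ j = i + 1) := by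
    constructor
    · rintro ⟨m, h⟩
      omega
    · exact fun h => ⟨(i - 4) / 2, by omega⟩
  simp [modQ, this, or_assoc]

theorem fruchtMany_edges : fruchtEdges g = (fruchtMany hn g hg).colourEdges := by
  have hQ : fruchtQ n = modQ n := if_neg (by omega)
  have hshift : fruchtShift n = 5 := if_neg (by omega)
  funext k
  refine colourEdges_eq _ ?_ ?_
  · rintro ⟨⟨i, hi⟩, h⟩ ⟨⟨j, hj⟩, h'⟩ hR
    rw [fruchtNum_eq hn] at hi hj
    rw [hQ, hshift] at hR
    apply fruchtMany_eq <;> dsimp only at hR ⊢ <;> rcases hR with ⟨h1, rfl⟩ | ⟨rfl, m, h1, h2, rfl⟩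
    · cases k
      · have := idxMany_red hn hi
        rw [mem_modQ_red] at h1
        omega
      · have := idxMany_green hn hi
        rw [mem_modQ_green] at h1
        omega
      · have := idxMany_blue hn hi
        rw [mem_modQ_blue] at h1
        omega
    · obtain rfl : i = 2 * (m : ℕ) + 7 := by omega
      rw [idxMany_red_odd]
      omega
    · cases k
      · rw [mem_modQ_red] at h1
        rw [voltMany_small g (by omega), mul_one]
      · exact (mul_one _).symm
      · exact (mul_one _).symm
    · obtain rfl : i = 2 * (m : ℕ) + 7 := by omega
      rw [voltMany_odd]
  · rintro ⟨⟨i, hi⟩, h⟩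
    have hi' := hi
    rw [fruchtNum_eq hn] at hi'
    simp only [fruchtMany_idx, fruchtMany_snd, hQ, hshift]
    cases k
    · rcases lt_or_ge i 7 with h7 | h7
      · rw [voltMany_small g h7, mul_one]
        have := idxMany_red hn hi'
        have : (i, idxMany n .red i) ∈ modQ n .red ∨ (idxMany n .red i, i) ∈ modQ n .red := by
          rw [mem_modQ_red, mem_modQ_red]
          omega
        exact this.imp (fun h => Or.inl ⟨h, rfl⟩) (fun h => Or.inl ⟨h, rfl⟩)
      · obtain ⟨j, rfl | rfl⟩ := exists_fin_of_ge hi'.2 h7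
        · refine Or.inl (Or.inr ⟨rfl, j, by omega, ?_, by rw [voltMany_odd]⟩)
          rw [idxMany_red_odd]
          omega
        · refine Or.inr (Or.inr ⟨rfl, j, ?_, by omega, ?_⟩)
          · rw [idxMany_red_even]
            omega
          · rw [voltMany_even, inv_mul_cancel_right]
    · have : (i, idxMany n .green i) ∈ modQ n .green ∨ (idxMany n .green i, i) ∈ modQ n .green := by
        rw [mem_modQ_green, mem_modQ_green]
        rcases idxMany_green hn hi' with h | h | h | h | h | h | h | h | h | h
        · exact Or.inl (by omega)
        · exact Or.inr (by omega)
        · exact Or.inl (by omega)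
        · exact Or.inr (by omega)
        · exact Or.inl (by omega)
        · exact Or.inr (by omega)
        · exact Or.inl (by omega)
        · exact Or.inr (by omega)
        · exact Or.inl (by omega)
        · exact Or.inr (by omega)
      exact this.imp (fun h => Or.inl ⟨h, mul_one _⟩) (fun h => Or.inl ⟨h, (mul_one _).symm⟩)
    · have : (i, idxMany n .blue i) ∈ modQ n .blue ∨ (idxMany n .blue i, i) ∈ modQ n .blue := by
        rw [mem_modQ_blue, mem_modQ_blue]
        rcases idxMany_blue hn hi' with h | h | h | h | h | h | h | h | h | h
        · exact Or.inl (by omega)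
        · exact Or.inr (by omega)
        · exact Or.inl (by omega)
        · exact Or.inr (by omega)
        · exact Or.inl (by omega)
        · exact Or.inr (by omega)
        · exact Or.inl (by omega)
        · exact Or.inr (by omega)
        · exact Or.inl (by omega)
        · exact Or.inr (by omega)
      exact this.imp (fun h => Or.inl ⟨h, mul_one _⟩) (fun h => Or.inl ⟨h, (mul_one _).symm⟩)

theorem fruchtMany_leftMul (m : G) (k : Colour) (x : FruchtNode n G) :
    leftMul _ G m ((fruchtMany hn g hg).s k x) = (fruchtMany hn g hg).s k (leftMul _ G m x) :=
  Prod.ext rfl (mul_assoc _ _ _).symm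

theorem fruchtMany_connected (hS : Subgroup.closure (Set.range g) = ⊤) :
    (fruchtMany hn g hg).Connected := by
  have h1 : 1 ≤ 1 ∧ 1 ≤ fruchtNum n := by rw [fruchtNum_eq hn]; omega
  -- Green and blue edges have trivial voltage and already connect each layer.
  have layer : ∀ P : FruchtNode n G → Prop, (∀ k x, P ((fruchtMany hn g hg).s k x) ↔ P x) →
      ∀ x : FruchtNode n G, P x ↔ P (⟨1, h1⟩, x.2) := by
    rintro P hP ⟨⟨i, hi⟩, h⟩
    have hi' := hi
    rw [fruchtNum_eq hn] at hi'
    have key : ∀ (k : Colour) (i j : ℕ) (hi : 1 ≤ i ∧ i ≤ fruchtNum n)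
        (hj : 1 ≤ j ∧ j ≤ fruchtNum n), j = idxMany n k i → voltMany g k i = 1 →
        (P (⟨j, hj⟩, h) ↔ P (⟨i, hi⟩, h)) := by
      rintro k i j hi hj rfl hv
      rw [← hP k (⟨i, hi⟩, h), ← fruchtMany_eq hn g hg (y := (⟨_, hj⟩, h)) rfl]
      rw [hv, mul_one]
    have hm : ∀ i, 1 ≤ i → i ≤ 8 → 1 ≤ i ∧ i ≤ fruchtNum n := by
      rw [fruchtNum_eq hn]
      omega
    have e2 := key .green 1 2 h1 (hm 2 (by omega) (by omega)) rfl rfl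
    have e3 := key .blue 1 3 h1 (hm 3 (by omega) (by omega)) rfl rfl
    have e4 := (key .blue 2 4 _ (hm 4 (by omega) (by omega)) rfl rfl).trans e2
    have e6 := (key .green 4 6 _ (hm 6 (by omega) (by omega)) rfl rfl).trans e4
    have e7 := (key .green 3 7 _ (hm 7 (by omega) (by omega)) rfl rfl).trans e3
    have e5 := (key .blue 7 5 _ (hm 5 (by omega) (by omega)) rfl rfl).trans e7
    have e8 := (key .green 5 8 _ (hm 8 (by omega) (by omega)) rfl rfl).trans e5
    have tail : ∀ i, 8 ≤ i → ∀ hi : 1 ≤ i ∧ i ≤ fruchtNum n,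
        (P (⟨i, hi⟩, h) ↔ P (⟨1, h1⟩, h)) := by
      intro i h8
      induction i, h8 using Nat.le_induction with
      | base => exact fun _ => e8
      | succ i h8 ih =>
        intro hi
        have hi' := hi
        rw [fruchtNum_eq hn] at hi'
        refine Iff.trans ?_ (ih ⟨by omega, by omega⟩)
        -- From index 8 on the layer is a path: blue leads upwards from even indices, green from odd
        -- ones.
        rcases Nat.mod_two_eq_zero_or_one i with h2 | h2
        · refine key .blue i (i + 1) _ hi ?_ rfl
          have := idxMany_blue hn (i := i) (by omega)
          omega
        · refine key .green i (i + 1) _ hi ?_ rfl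
          have := idxMany_green hn (i := i) (by omega)
          omega
    rcases lt_or_ge i 8 with h8 | h8
    · obtain ⟨hi1, hi2⟩ := hi
      interval_cases i
      · rfl
      · exact e2
      · exact e3
      · exact e4
      · exact e5
      · exact e6
      · exact e7
    · exact tail i h8 hi
  refine connected_of_generates hS (fun h => (⟨1, h1⟩, h)) ?_ ?_
  · exact fun P hP x => ⟨x.2, layer P hP x⟩
  · rintro P hP _ ⟨j, rfl⟩ h
    have hj := j.2
    have hm : 1 ≤ 2 * (j : ℕ) + 7 ∧ 2 * (j : ℕ) + 7 ≤ fruchtNum n := by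
      rw [fruchtNum_eq hn]
      omega
    have e := hP .red (⟨2 * j + 7, hm⟩, h)
    rw [layer P hP, layer P hP (⟨2 * j + 7, hm⟩, h), fruchtMany_snd, voltMany_odd] at e
    exact e

/-- The test words avoid the red edges of the generators, so they close in the covering at index 1.
For the image only its index is examined, so no relation between the generators has to be excluded.
-/
theorem fruchtMany_rigid (φ : FruchtNode n G → FruchtNode n G) (τ : Colour → Colour)
    (hτ : Function.Injective τ)
    (hφ : ∀ k x, φ ((fruchtMany hn g hg).s k x) = (fruchtMany hn g hg).s (τ k) (φ x)) :
    (∀ k, τ k = k) ∧ ∃ m x, φ x = leftMul _ G m x := by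
  have h1 : 1 ≤ 1 ∧ 1 ≤ fruchtNum n := by rw [fruchtNum_eq hn]; omega
  set T := fruchtMany hn g hg with hT
  let x : FruchtNode n G := (⟨1, h1⟩, 1)
  have hx : (x.1 : ℕ) = 1 := rfl
  have hx' : x.2 = 1 := rfl
  -- Each of the three closed words is recorded as two half-paths with the same end; involutivity
  -- then closes it in `F1`, `F2` and `F3`.
  have e1 : T.s .green x = T.s .red (T.s .blue x) :=
    Prod.ext (Subtype.ext rfl)
      (by simp [hT, fruchtMany_snd, fruchtMany_idx, hx, hx', idxMany, voltMany])
  have e2 : T.s .green (T.s .red x) = T.s .blue (T.s .green x) :=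
    Prod.ext (Subtype.ext rfl)
      (by simp [hT, fruchtMany_snd, hx, hx', voltMany])
  have e3 : T.s .red (T.s .blue (T.s .green x)) = T.s .blue (T.s .green (T.s .blue x)) :=
    Prod.ext (Subtype.ext rfl)
      (by simp [hT, fruchtMany_snd, fruchtMany_idx, hx, hx', idxMany, voltMany])
  have F1 : T.s (τ .blue) (T.s (τ .red) (T.s (τ .green) (φ x))) = φ x := by
    rw [← hφ, ← hφ, ← hφ, e1, T.invol, T.invol]
  have F2 : T.s (τ .green) (T.s (τ .blue) (T.s (τ .green) (T.s (τ .red) (φ x)))) = φ x := by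
    rw [← hφ, ← hφ, ← hφ, ← hφ, e2, T.invol, T.invol]
  have F3 : T.s (τ .blue) (T.s (τ .green) (T.s (τ .blue) (T.s (τ .red) (T.s (τ .blue)
      (T.s (τ .green) (φ x)))))) = φ x := by
    rw [← hφ, ← hφ, ← hφ, ← hφ, ← hφ, ← hφ, e3, T.invol, T.invol, T.invol]
  have hy := And.intro (φ x).1.2.1 ((φ x).1.2.2.trans_eq (fruchtNum_eq hn))
  obtain ⟨⟨hr, hg, hb⟩, hi⟩ := idxMany_closed hn hy (Colour.injective_cases hτ)
    (congrArg (fun y => (y.1 : ℕ)) F1) (congrArg (fun y => (y.1 : ℕ)) F2)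
    (congrArg (fun y => (y.1 : ℕ)) F3)
  refine ⟨fun k => by cases k <;> assumption, (φ x).2, x, ?_⟩
  exact Prod.ext (Subtype.ext hi) (mul_one _).symm

end ManyGenerators
end TriInvolution

/-! ### The main theorem -/

/-- Every finite group is the automorphism group of a closed simplicial surface. -/
theorem exists_surface (G : Type u) [Group G] [Finite G] :
    ∃ (α : Type u) (X : SimplicialSurface α), Nonempty (X.Aut ≃* G) := by
  classical
  rcases subsingleton_or_nontrivial G with _ | _
  · exact exists_surface_of_subsingleton G
  obtain ⟨a, ha⟩ := exists_ne (1 : G)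
  let e := Finite.equivFin (G × Fin 3)
  have hn : 2 < Nat.card (G × Fin 3) := by
    have : 0 < Nat.card G := Nat.card_pos
    rw [Nat.card_prod, Nat.card_fin]
    omega
  -- All elements of `G` are listed three times, so that the list has more than two entries, and 1
  -- is replaced by `a`; repetitions are harmless for `fruchtMany`.
  let g : Fin (Nat.card (G × Fin 3)) → G := fun i => if (e.symm i).1 = 1 then a else (e.symm i).1
  have hg : ∀ j, g j ≠ 1 := by
    intro j
    simp only [g]
    split_ifs with h
    · exact ha
    · exact h
  have hS : Subgroup.closure (Set.range g) = ⊤ := by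
    refine eq_top_iff.2 fun x _ => ?_
    by_cases hx : x = 1
    · exact hx ▸ one_mem _
    · exact Subgroup.subset_closure ⟨e (x, 0), by simp [g, hx]⟩
  have hM : 1 ≤ fruchtNum (Nat.card (G × Fin 3)) := by
    rw [TriInvolution.fruchtNum_eq hn]
    omega
  obtain ⟨-, c, -, -, -, -, α, X, _, h⟩ := TriInvolution.isCubic_and_exists_surface hM
    (TriInvolution.fruchtMany hn g hg) (TriInvolution.fruchtMany_leftMul hn g hg) _ rfl True
    (TriInvolution.fruchtMany_connected hn g hg hS)
    fun _ => TriInvolution.fruchtMany_rigid hn g hg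
  obtain ⟨Φ, -⟩ := h trivial
  exact ⟨α, X, ⟨Φ.symm⟩⟩

theorem mainTheorem2 {G : Type u} [Group G] [Finite G] (S : Set G)
    (hS : Subgroup.closure S = ⊤) :
    (∃ (α : Type u) (X : SimplicialSurface α), Nonempty (X.Aut ≃* G)) ∧
    ∀ (n : ℕ) (g : Fin n → G), 2 ≤ n → Function.Injective g → Set.range g = S → (1 : G) ∉ S →
      IsCubic (fruchtGraph g) ∧
      ∃ c : (fruchtGraph g).lineGraph.Coloring Colour,
        (∀ (e : (fruchtGraph g).edgeSet) (k : Colour),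
          c e = k ↔ (e : Sym2 (FruchtNode n G)) ∈ fruchtEdges g k) ∧
        (∀ (m : G) (k : Colour),
          Sym2.map (fruchtTranslate n m) '' fruchtEdges g k = fruchtEdges g k) ∧
        IsCycleDoubleCover (fruchtGraph g) (bicolouredCycles (fruchtGraph g) c) ∧
        (∀ (m : G), ∀ C ∈ bicolouredCycles (fruchtGraph g) c,
          Sym2.map (fruchtTranslate n m) '' C ∈ bicolouredCycles (fruchtGraph g) c) ∧
        ∃ (α : Type u) (X : SimplicialSurface α)
          (I : X.CoverIso (fruchtGraph g) (bicolouredCycles (fruchtGraph g) c)),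
          (n = 2 → ∀ i j, i ≠ j → g i * g j ≠ 1) →
          ∃ Φ : G ≃* X.Aut, ∀ (m : G) (x : FruchtNode n G),
            (Φ m : Equiv.Perm α) (I.faceEquiv.symm x : α) =
              (I.faceEquiv.symm (fruchtTranslate n m x) : α) := by
  refine ⟨exists_surface G, ?_⟩
  rintro n g h2 - rfl h1
  have hg : ∀ j, g j ≠ 1 := fun j hj => h1 ⟨j, hj⟩
  rcases h2.eq_or_lt with rfl | hn
  · exact TriInvolution.isCubic_and_exists_surface (by decide) (TriInvolution.fruchtTwo g hg)
      (TriInvolution.fruchtTwo_leftMul g hg) _ (TriInvolution.fruchtTwo_edges g hg) _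
      (TriInvolution.fruchtTwo_connected g hg hS)
      -- One order of the factors suffices: in a group `g 0 * g 1 = 1` if and only if `g 1 * g 0 =
      -- 1`.
      fun hp => TriInvolution.fruchtTwo_rigid g hg (hp rfl 0 1 (by decide))
  · exact TriInvolution.isCubic_and_exists_surface (by rw [TriInvolution.fruchtNum_eq hn]; omega)
      (TriInvolution.fruchtMany hn g hg) (TriInvolution.fruchtMany_leftMul hn g hg) _
      (TriInvolution.fruchtMany_edges hn g hg) _
      (TriInvolution.fruchtMany_connected hn g hg hS)
      fun _ => TriInvolution.fruchtMany_rigid hn g hg
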